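/- **Setting.** Let $\mathcal H$ be a separable Hilbert space over $\mathbb K\in\{\mathbb R,\mathbb C\}$, let $a(\cdot,\cdot)$ be a hermitian, continuous sesquilinear form with $a(v,v)\ge\alpha\|v\|_{\mathcal H}^2$ for some $\alpha>0$ and all $v\in\mathcal H$, let $\mathcal K:\mathcal H\to\mathcal H^*$ be compact and linear, and let $f\in\mathcal H^*$. Put $b(w,v)=a(w,v)+\langle\mathcal Kw,v\rangle$, suppose that $w=0$ is the only $w\in\mathcal H$ with $b(w,\cdot)=0$, and let $u\in\mathcal H$ solve $b(u,v)=\langle f,v\rangle$ for all $v\in\mathcal H$. For a finite-dimensional subspace $\mathcal X\subseteq\mathcal H$, let $\gamma(\mathcal X)=\inf_{W\in\mathcal X\setminus\{0\}}\sup_{V\in\mathcal X\setminus\{0\}}|b(W,V)|/(\|W\|_{\mathcal H}\|V\|_{\mathcal H})$. Let $\mathcal T_0$ be an initial triangulation of $\Omega\subset\mathbb R^d$, without any assumption on its fineness. Let $\mathrm{refine}(\mathcal T,\mathcal M)$ be a mesh-refinement strategy which returns, for a conforming $\mathcal T$ and $\mathcal M\subseteq\mathcal T$, a conforming refinement of $\mathcal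 T$ with the minimal number of elements in which all elements of $\mathcal M$ are refined. Write $\mathcal T_+\in\mathrm{refine}(\mathcal T)$ if $\mathcal T_+$ is obtained from $\mathcal T$ by finitely many such steps, and $\mathbb T=\mathrm{refine}(\mathcal T_0)$. Refinement contracts the local mesh-size on refined elements by a uniform factor $q_{\rm mesh}<1$. Each $\mathcal T_\star\in\mathbb T$ has a finite-dimensional space $\mathcal X_\star\subseteq\mathcal H$; these spaces are nested under refinement, and $\overline{\bigcup_\ell\mathcal X_\ell}=\mathcal H$ for each sequence of successive refinements of $\mathcal T_0$ with infinitely many uniform steps $\mathcal T_{\ell+1}=\mathrm{refine}(\mathcal T_\ell,\mathcal T_\ell)$. We say that $U_\star$ exists if there is a unique $U_\star\in\mathcal X_\star$ with $b(U_\star,V)=\langle f,V\rangle$ for all $V\in\mathcal X_\star$. Let $\eta_\star(T)\ge0$, $T\in\mathcal T_\star$, be local indicators, $\eta_\star(\mathcal U)=(\sum_{T\in\mathcal U}\eta_\star(T)^2)^{1/2}$ and $\eta_\star=\eta_\star(\mathcal T_\star)$. **Axioms.** There are $C_{\rm stb},C_{\rm red},C_{\rm rel}',C_{\rm rel}>0$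 and $0<q_{\rm red}<1$ such that for all $\mathcal T_\star\in\mathbb T$ and $\mathcal T_+\in\mathrm{refine}(\mathcal T_\star)$ for which $U_\star$ and $U_+$ exist (in (A3): $U_\star$ exists), (A1) $|\eta_+(\mathcal T_+\cap\mathcal T_\star)-\eta_\star(\mathcal T_+\cap\mathcal T_\star)|\le C_{\rm stb}\|U_+-U_\star\|_{\mathcal H}$; (A2) $\eta_+(\mathcal T_+\setminus\mathcal T_\star)^2\le q_{\rm red}\,\eta_\star(\mathcal T_\star\setminus\mathcal T_+)^2+C_{\rm red}^2\|U_+-U_\star\|_{\mathcal H}^2$; (A3) $\|u-U_\star\|_{\mathcal H}\le C_{\rm rel}'\eta_\star$; (A4) there is $\mathcal R$ with $\mathcal T_\star\setminus\mathcal T_+\subseteq\mathcal R\subseteq\mathcal T_\star$, $\#\mathcal R\le C_{\rm rel}\#(\mathcal T_\star\setminus\mathcal T_+)$ and $\|U_+-U_\star\|_{\mathcal H}\le C_{\rm rel}\,\gamma(\mathcal X_+)^{-1}\eta_\star(\mathcal R)$. **Mesh properties.** One refinement step splits each refined element into at least $2$ and at most $C_{\rm son}$ elements, and for all $\mathcal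 T\in\mathbb T$ and $\mathcal T_1,\mathcal T_2\in\mathrm{refine}(\mathcal T)$ there is $\mathcal T'\in\mathrm{refine}(\mathcal T_1)\cap\mathrm{refine}(\mathcal T_2)$ with $\#\mathcal T'\le\#\mathcal T_1+\#\mathcal T_2-\#\mathcal T$. **Algorithm.** Let $\theta>0$, $C_{\rm mark}\ge1$, $U_{-1}=0$, $\eta_{-1}=1$. For $\ell=0,1,2,\dots$: if $U_\star$ does not exist for $\mathcal T_\star=\mathcal T_\ell$, let $U_\ell=U_{\ell-1}$, $\eta_\ell=\eta_{\ell-1}$ and $\mathcal M_\ell=\mathcal T_\ell$; otherwise, let $U_\ell$ and $\eta_\ell$ be the discrete solution and the estimator on $\mathcal T_\ell$ and let $\mathcal M_\ell\subseteq\mathcal T_\ell$ be a set, of minimal cardinality up to the factor $C_{\rm mark}$, with $\theta\eta_\ell^2\le\eta_\ell(\mathcal M_\ell)^2$. In both cases, $\mathcal T_{\ell+1}=\mathrm{refine}(\mathcal T_\ell,\mathcal M_\ell)$. We consider runs for which (A5) $\mathcal X_\infty:=\overline{\bigcup_\ell\mathcal X_\ell}$ contains no $w\ne0$ with $b(w,v)=0$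 for all $v\in\mathcal X_\infty$, and for which $\mathcal X_\infty=\mathcal H$ and $\#\mathcal T_\ell-\#\mathcal T_0\le C_{\rm mesh}\sum_{j<\ell}\#\mathcal M_j$ for all $\ell$, with a constant $C_{\rm mesh}\ge1$. **Approximation class.** For $s>0$, let $\|u\|_{\mathbb A_s}=\sup_{N\in\mathbb N_0}(N+1)^s\min_{\mathcal T_\star\in\mathbb T_N}\eta_\star\in[0,\infty]$, where $\mathbb T_N$ is the set of all $\mathcal T_\star\in\mathbb T$ with $\#\mathcal T_\star-\#\mathcal T_0\le N$ for which $U_\star$ exists, and $\min\emptyset:=0$. **Theorem.** For $m\in\mathbb N_0$, let $\widehat{\mathcal T}_0$, with space $\widehat{\mathcal X}_0$, be the $m$-times uniform refinement of $\mathcal T_0$, and for $\widehat\gamma_0>0$ let $\theta_{\rm opt}=(1+C_{\rm stb}^2C_{\rm rel}^2/\widehat\gamma_0^2)^{-1}$. (i) There are $m$ and $\widehat\gamma_0>0$ such that $\gamma(\mathcal X)\ge\widehat\gamma_0$ for all finite-dimensional $\mathcal X$ with $\widehat{\mathcal X}_0\subseteq\mathcal X\subseteq\mathcal H$. (ii)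 Let $m$ and $\widehat\gamma_0>0$ be such that $\gamma(\mathcal X_\star)\ge\widehat\gamma_0$ for all $\mathcal T_\star\in\mathrm{refine}(\widehat{\mathcal T}_0)$, and let $0<\theta<\theta_{\rm opt}$. Then there is $0<\varepsilon<1$ such that each run has an index $\ell_3$ with $$a(u-U_{\ell+1},u-U_{\ell+1})+a(U_{\ell+1}-U_\ell,U_{\ell+1}-U_\ell)\le\tfrac1{1-\varepsilon}\,a(u-U_\ell,u-U_\ell)\quad\text{for all }\ell\ge\ell_3,$$ and such that the following holds for all $s>0$ and $n\in\mathbb N_0$: There is $C_{\rm opt}>0$, which does not depend on the run, such that for all $C\ge C_{\rm opt}$, for each run, for each such $\ell_3$ and for each $\ell_5$ with $\mathcal T_\ell\in\mathrm{refine}(\widehat{\mathcal T}_0)$ for all $\ell\ge\ell_5$, it holds with $\ell_6=\max\{\ell_3,\ell_5\}$, provided that $\#\mathcal T_{\ell_6}=n$, $$\|u\|_{\mathbb A_s}<\infty\iff\forall\ell\ge\ell_6:\ \eta_\ell\le C\,(\#\mathcal T_\ell-\#\mathcal T_0+1)^{-s}.$$ (iii) Let $m$ and $\widehat\gamma_0$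 be as in (i), and let $0<\theta<\theta_{\rm opt}$. Then each run has an index $\ell_6$ such that for all $s>0$ there is $C_{\rm opt}>0$ such that the equivalence in (ii) holds for all $C\ge C_{\rm opt}$. -/

import Mathlib

open MeasureTheory

noncomputable section

namespace AFEM

/-! ### Triangulations and mesh refinement -/

/-- A triangulation of `Ω ⊆ ℝᵈ`: finitely many compact elements of positive volume which cover the
closure of `Ω` and overlap only in null sets. The shape of the elements and the notion of conformity
are left to the refinement strategy. -/
@[ext]
structure Triangulation {d : ℕ} (Ω : Set (EuclideanSpace ℝ (Fin d))) where
  elems : Finset (Set (EuclideanSpace ℝ (Fin d)))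
  isCompact : ∀ E ∈ elems, IsCompact E
  volume_pos : ∀ E ∈ elems, 0 < volume E
  cover : ⋃ E ∈ elems, E = closure Ω
  overlap : ∀ E ∈ elems, ∀ E' ∈ elems, E ≠ E' → volume (E ∩ E') = 0

variable {d : ℕ} {Ω : Set (EuclideanSpace ℝ (Fin d))}

/-- The number of elements `#𝒯`. -/
def Triangulation.card (T : Triangulation Ω) : ℕ := T.elems.card

open Classical in
/-- `𝒯 ∖ 𝒯'`, the elements of `𝒯` which are not in `𝒯'`. -/
def Triangulation.sdiff (T T' : Triangulation Ω) : Finset (Set (EuclideanSpace ℝ (Fin d))) :=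
  T.elems \ T'.elems

open Classical in
/-- `𝒯 ∩ 𝒯'`, the common elements. -/
def Triangulation.inter (T T' : Triangulation Ω) : Finset (Set (EuclideanSpace ℝ (Fin d))) :=
  T.elems ∩ T'.elems

open Classical in
/-- The sons in `𝒯` of an element `E` of a coarser triangulation. -/
def Triangulation.sons (T : Triangulation Ω) (E : Set (EuclideanSpace ℝ (Fin d))) :
    Finset (Set (EuclideanSpace ℝ (Fin d))) :=
  T.elems.filter (fun E' => E' ⊆ E)

/-- Every element of `T` is the union of the elements of `T'` which it contains. -/
def Triangulation.Subdivides (T' T : Triangulation Ω) : Prop :=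
  ∀ E ∈ T.elems, E = ⋃ E' ∈ T'.sons E, E'

/-- The local mesh-size `|E|^{1/d}`. -/
def meshSize (E : Set (EuclideanSpace ℝ (Fin d))) : ℝ :=
  (volume E).toReal ^ (1 / (d : ℝ))

/-- A mesh-refinement strategy: for a conforming triangulation `T` and marked elements `M ⊆ T`,
`refine T M` is a conforming refinement of `T` in which all elements of `M` are refined, and it has
the minimal number of elements among all of these. `Conforming` is the class of
triangulations with which the strategy works. -/
structure RefinementStrategy (Ω : Set (EuclideanSpace ℝ (Fin d))) where
  Conforming : Triangulation Ω → Prop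
  refine : Triangulation Ω → Finset (Set (EuclideanSpace ℝ (Fin d))) → Triangulation Ω
  conforming_refine : ∀ T M, Conforming T → M ⊆ T.elems → Conforming (refine T M)
  subdivides_refine : ∀ T M, Conforming T → M ⊆ T.elems → (refine T M).Subdivides T
  marked_refined : ∀ T M, Conforming T → M ⊆ T.elems → M ⊆ T.sdiff (refine T M)
  card_minimal : ∀ T M, Conforming T → M ⊆ T.elems → ∀ T', Conforming T' → T'.Subdivides T →
    M ⊆ T.sdiff T' → (refine T M).card ≤ T'.card

/-- `S.Refines T T'` means `T' ∈ refine(T)`: `T'` is obtained from `T` by finitely many steps. -/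
def RefinementStrategy.Refines (S : RefinementStrategy Ω) : Triangulation Ω → Triangulation Ω → Prop :=
  Relation.ReflTransGen (fun T T' => ∃ M, M ⊆ T.elems ∧ T' = S.refine T M)

/-- One step of uniform refinement. -/
def RefinementStrategy.uniformStep (S : RefinementStrategy Ω) (T : Triangulation Ω) :
    Triangulation Ω :=
  S.refine T T.elems

/-! ### The continuous problem -/

variable {𝕜 : Type*} [RCLike 𝕜] {H : Type*} [NormedAddCommGroup H] [InnerProductSpace 𝕜 H]

/-- A well-posed, compactly perturbed elliptic problem
`b(u, v) := a(u, v) + ⟨K u, v⟩ = ⟨f, v⟩` for all `v`. Sesquilinear forms are linear in the first and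
conjugate-linear in the second argument, so the dual space consists of the continuous
conjugate-linear functionals. -/
structure Problem (𝕜 : Type*) [RCLike 𝕜] (H : Type*) [NormedAddCommGroup H]
    [InnerProductSpace 𝕜 H] where
  a : H →L[𝕜] H →L⋆[𝕜] 𝕜
  K : H →L[𝕜] H →L⋆[𝕜] 𝕜
  f : H →L⋆[𝕜] 𝕜
  u : H
  hermitian : ∀ v w, a v w = starRingEnd 𝕜 (a w v)
  elliptic : ∃ α : ℝ, 0 < α ∧ ∀ v, α * ‖v‖ ^ 2 ≤ RCLike.re (a v v)
  compact : IsCompactOperator K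
  wellPosed : ∀ w, w = 0 ↔ ∀ v, (a + K) w v = 0
  solves : ∀ v, (a + K) u v = f v

namespace Problem

variable (P : Problem 𝕜 H)

/-- `b(w, v) = a(w, v) + ⟨K w, v⟩`. -/
def b : H →L[𝕜] H →L⋆[𝕜] 𝕜 := P.a + P.K

/-- The squared energy norm `a(v, v)`. -/
def energySq (v : H) : ℝ := RCLike.re (P.a v v)

/-- `U ∈ V` solves the Galerkin formulation in the subspace `V`. -/
def IsGalerkinSolution (V : Submodule 𝕜 H) (U : H) : Prop :=
  U ∈ V ∧ ∀ v ∈ V, P.b U v = P.f v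

/-- The Galerkin formulation in `V` has a unique solution. -/
def Solvable (V : Submodule 𝕜 H) : Prop := ∃! U, P.IsGalerkinSolution V U

open Classical in
/-- The Galerkin solution in `V`; the value `0` for `V` without unique solution is never used. -/
def galerkin (V : Submodule 𝕜 H) : H :=
  if h : P.Solvable V then h.choose else 0

/-- The inf-sup constant
`inf_{W ∈ V∖{0}} sup_{v ∈ V∖{0}} |b(W, v)| / (‖W‖ ‖v‖)` (which is `∞` for `V = {0}`). -/
def infSup (V : Submodule 𝕜 H) : ENNReal :=
  ⨅ W ∈ {W : H | W ∈ V ∧ W ≠ 0}, ⨆ v ∈ {v : H | v ∈ V ∧ v ≠ 0},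
    ENNReal.ofReal (‖P.b W v‖ / (‖W‖ * ‖v‖))

end Problem

/-! ### The discretization and the error estimator -/

/-- An initial mesh `T0` with a refinement strategy, discrete spaces `X T` for all refinements `T`
of `T0`, and local refinement indicators `η T E` for the elements `E` of `T`. (The indicators may
depend on the Galerkin solution in `X T`, which is determined by `T`.) -/
structure Discretization (𝕜 : Type*) [RCLike 𝕜] (H : Type*) [NormedAddCommGroup H]
    [InnerProductSpace 𝕜 H] (Ω : Set (EuclideanSpace ℝ (Fin d))) where
  S : RefinementStrategy Ω
  T0 : Triangulation Ω
  conforming_T0 : S.Conforming T0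
  contraction : ∃ q : ℝ, 0 < q ∧ q < 1 ∧ ∀ T T', S.Refines T0 T → S.Refines T T' →
    ∀ E ∈ T.sdiff T', ∀ E' ∈ T'.sons E, meshSize E' ≤ q * meshSize E
  X : Triangulation Ω → Submodule 𝕜 H
  finiteDimensional : ∀ T, S.Refines T0 T → FiniteDimensional 𝕜 (X T)
  nested : ∀ T T', S.Refines T0 T → S.Refines T T' → X T ≤ X T'
  /-- Infinitely many steps of uniform refinement lead to a dense subspace. -/
  dense : ∀ (T : ℕ → Triangulation Ω) (M : ℕ → Finset (Set (EuclideanSpace ℝ (Fin d)))),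
    T 0 = T0 → (∀ l, M l ⊆ (T l).elems) → (∀ l, T (l + 1) = S.refine (T l) (M l)) →
    {l | M l = (T l).elems}.Infinite → closure (⋃ l, (X (T l) : Set H)) = Set.univ
  η : Triangulation Ω → Set (EuclideanSpace ℝ (Fin d)) → ℝ
  η_nonneg : ∀ T, S.Refines T0 T → ∀ E ∈ T.elems, 0 ≤ η T E

namespace Discretization

variable (P : Problem 𝕜 H) (D : Discretization 𝕜 H Ω)

/-- `T ∈ 𝕋 = refine(T0)`. -/
def Admissible (T : Triangulation Ω) : Prop := D.S.Refines D.T0 T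

/-- The discrete solution `U_T ∈ X T` exists (uniquely). -/
def Solvable (T : Triangulation Ω) : Prop := P.Solvable (D.X T)

/-- The discrete solution `U_T`. -/
def sol (T : Triangulation Ω) : H := P.galerkin (D.X T)

/-- `η_T(𝒰) = (∑_{E ∈ 𝒰} η_T(E)²)^{1/2}`. -/
def etaOn (T : Triangulation Ω) (A : Finset (Set (EuclideanSpace ℝ (Fin d)))) : ℝ :=
  Real.sqrt (∑ E ∈ A, D.η T E ^ 2)

/-- The error estimator `η_T = η_T(T)`. -/
def eta (T : Triangulation Ω) : ℝ := D.etaOn T T.elems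

/-- (A1) stability on non-refined element domains. -/
def Stability (Cstb : ℝ) : Prop :=
  ∀ T T', D.Admissible T → D.S.Refines T T' → D.Solvable P T → D.Solvable P T' →
    |D.etaOn T' (T'.inter T) - D.etaOn T (T'.inter T)| ≤ Cstb * ‖D.sol P T' - D.sol P T‖

/-- (A2) reduction on refined element domains. -/
def Reduction (Cred qred : ℝ) : Prop :=
  ∀ T T', D.Admissible T → D.S.Refines T T' → D.Solvable P T → D.Solvable P T' →
    D.etaOn T' (T'.sdiff T) ^ 2 ≤
      qred * D.etaOn T (T.sdiff T') ^ 2 + Cred ^ 2 * ‖D.sol P T' - D.sol P T‖ ^ 2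

/-- (A3) reliability. -/
def Reliability (Crel' : ℝ) : Prop :=
  ∀ T, D.Admissible T → D.Solvable P T → ‖P.u - D.sol P T‖ ≤ Crel' * D.eta T

/-- (A4) discrete reliability, with the inf-sup constant of the finer space. -/
def DiscreteReliability (Crel : ℝ) : Prop :=
  ∀ T T', D.Admissible T → D.S.Refines T T' → ∃ R, R ⊆ T.elems ∧
    (D.Solvable P T → D.Solvable P T' →
      ‖D.sol P T' - D.sol P T‖ ≤ Crel * (P.infSup (D.X T')).toReal⁻¹ * D.etaOn T R ∧
      T.sdiff T' ⊆ R ∧ (R.card : ℝ) ≤ Crel * ((T.sdiff T').card : ℝ))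

/-- Each refined element is split into at least `2` and at most `Cson` sons. -/
def SonBounds (Cson : ℕ) : Prop :=
  ∀ T M, D.Admissible T → M ⊆ T.elems → ∀ E ∈ T.sdiff (D.S.refine T M),
    2 ≤ ((D.S.refine T M).sons E).card ∧ ((D.S.refine T M).sons E).card ≤ Cson

/-- Overlay estimate: `#(T₁ ⊕ T₂) ≤ #T₁ + #T₂ - #T` for a common refinement `T₁ ⊕ T₂`. -/
def Overlay : Prop :=
  ∀ T T₁ T₂, D.Admissible T → D.S.Refines T T₁ → D.S.Refines T T₂ →
    ∃ T', D.S.Refines T₁ T' ∧ D.S.Refines T₂ T' ∧ T'.card + T.card ≤ T₁.card + T₂.card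

/-- The `m`-times uniform refinement of the initial mesh. -/
def uniform (m : ℕ) : Triangulation Ω := D.S.uniformStep^[m] D.T0

/-- `𝕋_N(T)`: all `T' ∈ refine(T)` with `#T' - #T ≤ N` for which the discrete solution exists. -/
def meshesUpTo (T : Triangulation Ω) (N : ℕ) : Set (Triangulation Ω) :=
  {T' | D.S.Refines T T' ∧ T'.card ≤ T.card + N ∧ D.Solvable P T'}

/-- `‖u‖_{𝔸_s} = sup_N (N + 1)^s min_{T ∈ 𝕋_N(T0)} η_T ∈ [0, ∞]`. The minimum over the empty set is
`0` by convention, which is the value of `sInf` there. -/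
def approxNorm (s : ℝ) : ENNReal :=
  ⨆ N : ℕ, ENNReal.ofReal (((N : ℝ) + 1) ^ s * sInf (D.eta '' D.meshesUpTo P D.T0 N))

end Discretization

/-! ### The adaptive algorithm -/

/-- Meshes and marked elements generated by the adaptive algorithm with marking parameters `θ` and
`Cmark`: uniform refinement if there is no unique discrete solution; otherwise, refinement of a set
which satisfies the Dörfler criterion and which has, up to the factor `Cmark`, minimal cardinality. -/
structure AdaptiveRun (P : Problem 𝕜 H) (D : Discretization 𝕜 H Ω) (θ Cmark : ℝ) where
  mesh : ℕ → Triangulation Ω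
  marked : ℕ → Finset (Set (EuclideanSpace ℝ (Fin d)))
  mesh_zero : mesh 0 = D.T0
  mesh_succ : ∀ l, mesh (l + 1) = D.S.refine (mesh l) (marked l)
  marked_subset : ∀ l, marked l ⊆ (mesh l).elems
  marked_uniform : ∀ l, ¬ D.Solvable P (mesh l) → marked l = (mesh l).elems
  doerfler : ∀ l, D.Solvable P (mesh l) →
    θ * D.eta (mesh l) ^ 2 ≤ D.etaOn (mesh l) (marked l) ^ 2
  marked_minimal : ∀ l, D.Solvable P (mesh l) → ∀ M, M ⊆ (mesh l).elems →
    θ * D.eta (mesh l) ^ 2 ≤ D.etaOn (mesh l) M ^ 2 → ((marked l).card : ℝ) ≤ Cmark * (M.card : ℝ)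

namespace AdaptiveRun

variable {P : Problem 𝕜 H} {D : Discretization 𝕜 H Ω} {θ Cmark : ℝ} (r : AdaptiveRun P D θ Cmark)

open Classical in
/-- The discrete solutions `U_ℓ` of the algorithm, with `U_{-1} = 0` and `U_ℓ = U_{ℓ-1}` if there is
no unique discrete solution. -/
def U : ℕ → H
  | 0 => if D.Solvable P (r.mesh 0) then D.sol P (r.mesh 0) else 0
  | l + 1 => if D.Solvable P (r.mesh (l + 1)) then D.sol P (r.mesh (l + 1)) else U l

open Classical in
/-- The estimators `η_ℓ` of the algorithm, with `η_{-1} = 1` and `η_ℓ = η_{ℓ-1}` if there is no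
unique discrete solution. -/
def est : ℕ → ℝ
  | 0 => if D.Solvable P (r.mesh 0) then D.eta (r.mesh 0) else 1
  | l + 1 => if D.Solvable P (r.mesh (l + 1)) then D.eta (r.mesh (l + 1)) else est l

/-- The discrete limit space `X_∞`, the closure of the union of all `X_ℓ`. -/
def limitSpace : Set H := closure (⋃ l, (D.X (r.mesh l) : Set H))

/-- (A5) definiteness of `b` on `X_∞`. -/
def LimitDefinite : Prop :=
  ∀ w ∈ r.limitSpace, (∀ v ∈ r.limitSpace, P.b w v = 0) → w = 0

/-- The mesh-closure estimate. -/
def MeshClosure (Cmesh : ℝ) : Prop :=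
  ∀ l, ((r.mesh l).card : ℝ) - (D.T0.card : ℝ) ≤
    Cmesh * ∑ j ∈ Finset.range l, ((r.marked j).card : ℝ)

/-- The quasi-orthogonality with parameter `ε` in the energy norm holds from the index `l₃` on. -/
def QuasiOrthogonalFrom (ε : ℝ) (l₃ : ℕ) : Prop :=
  ∀ l ≥ l₃, P.energySq (P.u - r.U (l + 1)) + P.energySq (r.U (l + 1) - r.U l) ≤
    1 / (1 - ε) * P.energySq (P.u - r.U l)

/-- `η_ℓ ≤ C (#T_ℓ - #T_0 + 1)^{-s}` for all `ℓ ≥ l₆`. -/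
def RateFrom (s C : ℝ) (l₆ : ℕ) : Prop :=
  ∀ l ≥ l₆, r.est l ≤ C * (((r.mesh l).card : ℝ) - (D.T0.card : ℝ) + 1) ^ (-s)

end AdaptiveRun

/-- `θ_opt = (1 + C_stb² C_rel² / γ²)⁻¹`. -/
def thetaOpt (Cstb Crel γ : ℝ) : ℝ := (1 + Cstb ^ 2 * Crel ^ 2 / γ ^ 2)⁻¹

end AFEM

end

/-!
On spaces that are rich enough, compactness of `K` makes `b` behave like the elliptic form `a`. This
gives the uniform inf-sup bound, and it gives quasi-orthogonality of the Galerkin solutions with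
every `ε > 0` from some index on. Perturbing the Pythagorean identity of the energy norm by a
small `ε` does not destroy the contraction of the quasi-error `C a(u - U_ℓ, u - U_ℓ) + η_ℓ²`
obtained from (A1), (A2), the Dörfler criterion and (A3), so that `η_ℓ` converges R-linearly.

For the rates, the overlay of `T_ℓ` with an almost optimal mesh reduces the estimator by a fixed
factor. By (A1) and (A4), the set `R` of discrete reliability then satisfies the Dörfler criterion
if `θ < θ_opt`. Minimality of the marked sets yields `#M_ℓ ≲ η_ℓ^(-1/s)`, and R-linear convergence
turns the mesh-closure sum into a geometric series.

In (iii), the inf-sup bound is known for discrete spaces above that of the uniform mesh, which the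
meshes of the run need not refine. But it implies `‖b(w, ·)‖ ≥ γ ‖w‖` for every `w`, and, again by
compactness of `K`, this lower bound passes with arbitrarily small loss to all sufficiently rich
spaces; since `θ < θ_opt` is an open condition on `γ`, the loss is harmless.
-/

noncomputable section

namespace AFEM

open Filter Topology

section WeakConvergence

variable {𝕜 : Type*} [RCLike 𝕜] {H : Type*} [NormedAddCommGroup H] [InnerProductSpace 𝕜 H]
  {ι : Type*}

variable (𝕜) in
/-- Weak convergence in a Hilbert space along a filter, tested with inner products. -/
def WeakTendsto (x : ι → H) (l : Filter ι) (w : H) : Prop :=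
  ∀ v : H, Tendsto (fun i => inner 𝕜 v (x i)) l (𝓝 (inner 𝕜 v w))

theorem exists_tendsto_of_mem_compact {α : Type*} [TopologicalSpace α] {s : Set α}
    (hs : IsCompact s) (l : Ultrafilter ι) {x : ι → α} (hx : ∀ i, x i ∈ s) :
    ∃ y, Tendsto x l (𝓝 y) := by
  obtain ⟨y, -, hy⟩ := hs.ultrafilter_le_nhds (l.map x) <|
    le_principal_iff.2 <| mem_map.2 <| univ_mem' hx
  exact ⟨y, hy⟩

theorem exists_weakTendsto [CompleteSpace H] (l : Ultrafilter ι) {x : ι → H} {C : ℝ}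
    (hx : ∀ i, ‖x i‖ ≤ C) : ∃ w : H, WeakTendsto 𝕜 x l w := by
  let φ : ι → WeakDual 𝕜 H := fun i => StrongDual.toWeakDual (InnerProductSpace.toDual 𝕜 H (x i))
  obtain ⟨ψ, hψ⟩ := exists_tendsto_of_mem_compact
    (WeakDual.isCompact_closedBall (0 : StrongDual 𝕜 H) C) l (x := φ)
    fun i => by simpa [φ] using hx i
  refine ⟨(InnerProductSpace.toDual 𝕜 H).symm (WeakDual.toStrongDual ψ), fun v => ?_⟩
  have hinner : Tendsto (fun i => inner 𝕜 (x i) v) l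
      (𝓝 (inner 𝕜 ((InnerProductSpace.toDual 𝕜 H).symm (WeakDual.toStrongDual ψ)) v)) := by
    rw [InnerProductSpace.toDual_symm_apply]
    exact ((WeakDual.eval_continuous v).tendsto ψ).comp hψ
  simpa only [Function.comp_def, inner_conj_symm] using
    (RCLike.continuous_conj.tendsto _).comp hinner

namespace WeakTendsto

variable {l : Filter ι} {x y : ι → H} {w z : H} {C : ℝ}

theorem sub (hx : WeakTendsto 𝕜 x l w) (hy : WeakTendsto 𝕜 y l z) :
    WeakTendsto 𝕜 (fun i => x i - y i) l (w - z) := fun v => by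
  simpa only [inner_sub_right] using (hx v).sub (hy v)

theorem of_tendsto (hx : Tendsto x l (𝓝 w)) : WeakTendsto 𝕜 x l w := fun _ =>
  tendsto_const_nhds.inner hx

theorem tendsto_inner (hx : WeakTendsto 𝕜 x l w) (hC : ∀ i, ‖x i‖ ≤ C)
    (hy : Tendsto y l (𝓝 z)) : Tendsto (fun i => inner 𝕜 (y i) (x i)) l (𝓝 (inner 𝕜 z w)) := by
  have hbound : Tendsto (fun i => ‖y i - z‖ * C) l (𝓝 0) := by
    simpa using (tendsto_iff_norm_sub_tendsto_zero.1 hy).mul_const C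
  have hdiff : Tendsto (fun i => inner 𝕜 (y i - z) (x i)) l (𝓝 0) :=
    squeeze_zero_norm (fun i => (norm_inner_le_norm _ _).trans
      (mul_le_mul_of_nonneg_left (hC i) (norm_nonneg _))) hbound
  simpa [inner_sub_left] using hdiff.add (hx z)

theorem tendsto_norm_add_smul_sq (hx : WeakTendsto 𝕜 x l 0) (hC : ∀ i, ‖x i‖ ≤ C)
    (hy : Tendsto y l (𝓝 z)) {L : ℝ} (hL : Tendsto (fun i => ‖x i‖ ^ 2) l (𝓝 L)) (t : ℝ) :
    Tendsto (fun i => ‖y i + (t : 𝕜) • x i‖ ^ 2) l (𝓝 (‖z‖ ^ 2 + t ^ 2 * L)) := by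
  have hcross : Tendsto (fun i => RCLike.re (inner 𝕜 (y i) (x i))) l (𝓝 0) := by
    simpa [Function.comp_def] using
      (RCLike.continuous_re.tendsto _).comp (hx.tendsto_inner hC hy)
  have hsum := ((hy.norm.pow 2).add ((hcross.const_mul t).const_mul 2)).add (hL.const_mul (t ^ 2))
  simp only [mul_zero, add_zero] at hsum
  refine hsum.congr fun i => ?_
  rw [norm_add_sq (𝕜 := 𝕜), inner_smul_right, RCLike.re_ofReal_mul, norm_smul,
    RCLike.norm_ofReal, mul_pow, sq_abs]

variable [CompleteSpace H]

theorem functional (hx : WeakTendsto 𝕜 x l w) (φ : H →L[𝕜] 𝕜) :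
    Tendsto (fun i => φ (x i)) l (𝓝 (φ w)) := by
  simpa [InnerProductSpace.toDual_symm_apply] using hx ((InnerProductSpace.toDual 𝕜 H).symm φ)

theorem map (hx : WeakTendsto 𝕜 x l w) (A : H →L[𝕜] H) :
    WeakTendsto 𝕜 (fun i => A (x i)) l (A w) := fun v =>
  hx.functional ((innerSL 𝕜 v).comp A)

theorem tendsto_of_isCompactOperator {F : Type*} [NormedAddCommGroup F] [NormedSpace 𝕜 F]
    {l : Ultrafilter ι} (hx : WeakTendsto 𝕜 x l w) (hC : ∀ i, ‖x i‖ ≤ C) {K : H →L[𝕜] F}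
    (hK : IsCompactOperator K) : Tendsto (fun i => K (x i)) l (𝓝 (K w)) := by
  obtain ⟨k, hk⟩ := exists_tendsto_of_mem_compact
    (hK.isCompact_closure_image_closedBall (f := (K : H →ₗ[𝕜] F)) C) l
    fun i => subset_closure ⟨x i, by simpa using hC i, rfl⟩
  have hk' : Tendsto (fun i => K (x i)) l (𝓝 k) := hk
  suffices k = K w by rwa [← this]
  refine (SeparatingDual.eq_iff_forall_dual_eq (R := 𝕜)).2 fun φ => ?_
  exact tendsto_nhds_unique ((φ.continuous.tendsto k).comp hk') (hx.functional (φ.comp K))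

end WeakTendsto

variable [CompleteSpace H]

/-- The Riesz operator of a bounded sesquilinear form `c`, given by `c w v = ⟪v, rieszOp c w⟫`. -/
def rieszOp (c : H →L[𝕜] H →L⋆[𝕜] 𝕜) : H →L[𝕜] H :=
  ContinuousLinearMap.adjoint (InnerProductSpace.continuousLinearMapOfBilin (𝕜 := 𝕜) c.flip)

theorem inner_rieszOp (c : H →L[𝕜] H →L⋆[𝕜] 𝕜) (v w : H) :
    inner 𝕜 v (rieszOp c w) = c w v := by
  rw [rieszOp, ContinuousLinearMap.adjoint_inner_right,
    InnerProductSpace.continuousLinearMapOfBilin_apply]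
  rfl

theorem norm_apply_le_norm_rieszOp (c : H →L[𝕜] H →L⋆[𝕜] 𝕜) (w : H) : ‖c w‖ ≤ ‖rieszOp c w‖ :=
  ContinuousLinearMap.opNorm_le_bound _ (norm_nonneg _) fun v => by
    rw [← inner_rieszOp, mul_comm]
    exact norm_inner_le_norm _ _

namespace WeakTendsto

variable {l : Filter ι} {x y : ι → H} {w z : H} {C : ℝ}

theorem tendsto_form_left (hx : WeakTendsto 𝕜 x l w) (hC : ∀ i, ‖x i‖ ≤ C)
    (hy : Tendsto y l (𝓝 z)) (c : H →L[𝕜] H →L⋆[𝕜] 𝕜) :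
    Tendsto (fun i => c (x i) (y i)) l (𝓝 (c w z)) := by
  simpa only [inner_rieszOp] using (hx.map (rieszOp c)).tendsto_inner
    (fun i => (rieszOp c).le_opNorm_of_le (hC i)) hy

theorem tendsto_form_right (hx : WeakTendsto 𝕜 x l w) (hC : ∀ i, ‖x i‖ ≤ C)
    (hy : Tendsto y l (𝓝 z)) (c : H →L[𝕜] H →L⋆[𝕜] 𝕜) :
    Tendsto (fun i => c (y i) (x i)) l (𝓝 (c z w)) := by
  have hconj := hx.tendsto_inner hC (((rieszOp c).continuous.tendsto z).comp hy)
  simpa only [Function.comp_def, inner_conj_symm, inner_rieszOp] using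
    (RCLike.continuous_conj.tendsto _).comp hconj

end WeakTendsto

end WeakConvergence

namespace Problem

variable {𝕜 : Type*} [RCLike 𝕜] {H : Type*} [NormedAddCommGroup H] [InnerProductSpace 𝕜 H]
  (P : Problem 𝕜 H)

section InfSup

variable {V : Submodule 𝕜 H} {γ : ℝ}

theorem exists_unit_of_infSup_lt (h : P.infSup V < ENNReal.ofReal γ) :
    ∃ W ∈ V, ‖W‖ = 1 ∧ ∀ v ∈ V, ‖P.b W v‖ ≤ γ * ‖v‖ := by
  simp only [infSup, iInf_lt_iff] at h
  obtain ⟨W, ⟨hW, hW0⟩, h⟩ := h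
  refine ⟨((‖W‖ : 𝕜)⁻¹) • W, V.smul_mem _ hW, norm_smul_inv_norm hW0, fun v hv => ?_⟩
  rcases eq_or_ne v 0 with rfl | hv0
  · simp
  have hquot : ENNReal.ofReal (‖P.b W v‖ / (‖W‖ * ‖v‖)) < ENNReal.ofReal γ :=
    lt_of_le_of_lt (le_iSup₂_of_le v ⟨hv, hv0⟩ le_rfl) h
  rw [ENNReal.ofReal_lt_ofReal_iff_of_nonneg (by positivity), ← div_div,
    div_lt_iff₀ (norm_pos_iff.2 hv0)] at hquot
  simpa [norm_smul, div_eq_inv_mul] using hquot.le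

theorem infSup_le {W : H} (hW : W ∈ V) (hW0 : W ≠ 0)
    (h : ∀ v ∈ V, ‖P.b W v‖ ≤ γ * ‖W‖ * ‖v‖) : P.infSup V ≤ ENNReal.ofReal γ := by
  refine iInf₂_le_of_le W ⟨hW, hW0⟩ (iSup₂_le fun v hv => ENNReal.ofReal_le_ofReal ?_)
  rw [div_le_iff₀ (mul_pos (norm_pos_iff.2 hW0) (norm_pos_iff.2 hv.2)), ← mul_assoc]
  exact h v hv.1

theorem eq_zero_of_infSup_pos (h : 0 < P.infSup V) {W : H} (hW : W ∈ V)
    (hWb : ∀ v ∈ V, P.b W v = 0) : W = 0 := by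
  by_contra hW0
  refine (P.infSup_le (γ := 0) hW hW0 fun v hv => ?_).not_gt (by simpa using h)
  simp [hWb v hv]

theorem toReal_infSup_inv_le (hγ : 0 < γ) (h : ENNReal.ofReal γ ≤ P.infSup V) :
    (P.infSup V).toReal⁻¹ ≤ γ⁻¹ := by
  by_cases htop : P.infSup V = ⊤
  · simp [htop, hγ.le]
  · exact inv_anti₀ hγ ((ENNReal.ofReal_le_iff_le_toReal htop).1 h)

theorem mul_norm_le_norm_b {F : Submodule 𝕜 H} [FiniteDimensional 𝕜 F]
    (hF : ∀ V : Submodule 𝕜 H, FiniteDimensional 𝕜 V → F ≤ V → ENNReal.ofReal γ ≤ P.infSup V)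
    (w : H) : γ * ‖w‖ ≤ ‖P.b w‖ := by
  rcases eq_or_ne w 0 with rfl | hw
  · simp
  have hpos : 0 < ‖w‖ := norm_pos_iff.2 hw
  have hle := (hF (F ⊔ Submodule.span 𝕜 {w}) inferInstance le_sup_left).trans <|
    P.infSup_le (γ := ‖P.b w‖ / ‖w‖)
      (Submodule.mem_sup_right (Submodule.mem_span_singleton_self w)) hw fun v _ => by
        rw [div_mul_cancel₀ _ hpos.ne']
        exact (P.b w).le_opNorm v
  rwa [ENNReal.ofReal_le_ofReal_iff (by positivity), le_div_iff₀ hpos] at hle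

end InfSup

section Galerkin

variable {V : Submodule 𝕜 H}

theorem b_apply (w v : H) : P.b w v = P.a w v + P.K w v := rfl

theorem b_u (v : H) : P.b P.u v = P.f v := P.solves v

theorem solvable_of_infSup_pos [FiniteDimensional 𝕜 V] [CompleteSpace H]
    (h : 0 < P.infSup V) : P.Solvable V := by
  let L : H →L[𝕜] V := V.orthogonalProjectionOnto.comp (rieszOp P.b)
  have hL : ∀ (W : H) (v : V), inner 𝕜 v (L W) = P.b W v := fun W v => by
    rw [← inner_rieszOp]
    exact Submodule.inner_orthogonalProjectionOnto_eq_of_mem_left v _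
  have hinj : Function.Injective ((L.comp V.subtypeL : V →L[𝕜] V) : V →ₗ[𝕜] V) := by
    refine (injective_iff_map_eq_zero _).2 fun W hW => Subtype.ext ?_
    refine P.eq_zero_of_infSup_pos h W.2 fun v hv => ?_
    have hLW : L W = 0 := hW
    rw [← hL W ⟨v, hv⟩, hLW, inner_zero_right]
  obtain ⟨U, hU⟩ := LinearMap.injective_iff_surjective.1 hinj (L P.u)
  have hUb : ∀ v ∈ V, P.b U v = P.f v := fun v hv => by
    have hLU : L U = L P.u := hU
    rw [← P.b_u, ← hL U ⟨v, hv⟩, ← hL P.u ⟨v, hv⟩, hLU]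
  refine ⟨U, ⟨U.2, hUb⟩, fun U' ⟨hU', hU'b⟩ => sub_eq_zero.1 ?_⟩
  refine P.eq_zero_of_infSup_pos h (V.sub_mem hU' U.2) fun v hv => ?_
  rw [map_sub, sub_apply, hU'b v hv, hUb v hv, sub_self]

theorem isGalerkinSolution_galerkin (h : P.Solvable V) :
    P.IsGalerkinSolution V (P.galerkin V) := by
  rw [galerkin, dif_pos h]
  exact h.choose_spec.1

theorem b_sub_galerkin_eq_zero (h : P.Solvable V) {v : H} (hv : v ∈ V) :
    P.b (P.u - P.galerkin V) v = 0 := by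
  rw [map_sub, sub_apply, (P.isGalerkinSolution_galerkin h).2 v hv, P.b_u, sub_self]

end Galerkin

section Energy

theorem energySq_nonneg (v : H) : 0 ≤ P.energySq v := by
  obtain ⟨α, hα, hell⟩ := P.elliptic
  exact le_trans (by positivity) (hell v)

theorem energySq_le (v : H) : P.energySq v ≤ ‖P.a‖ * ‖v‖ ^ 2 :=
  (RCLike.re_le_norm _).trans ((P.a.le_opNorm₂ v v).trans_eq (by ring))

theorem energySq_add (v w : H) :
    P.energySq (v + w) = P.energySq v + P.energySq w + 2 * RCLike.re (P.a v w) := by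
  simp only [energySq, map_add, add_apply]
  rw [P.hermitian w v, RCLike.conj_re]
  ring

theorem energySq_smul (t : ℝ) (v : H) : P.energySq ((t : 𝕜) • v) = t ^ 2 * P.energySq v := by
  simp only [energySq, map_smul, smul_apply, ContinuousLinearMap.map_smulₛₗ,
    RCLike.conj_ofReal, smul_eq_mul, RCLike.re_ofReal_mul]
  ring

theorem exists_a_apply_eq_inner [CompleteSpace H] :
    ∃ B : H →L[𝕜] H, ∀ z v, P.a (B z) v = inner 𝕜 v z := by
  obtain ⟨α, hα, hell⟩ := P.elliptic
  have hunit : IsUnit (rieszOp P.a) := by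
    refine ContinuousLinearMap.isUnit_of_forall_le_norm_inner_map _ (c := ⟨α, hα.le⟩) hα fun x => ?_
    rw [norm_inner_symm, inner_rieszOp, mul_comm]
    exact (hell x).trans (RCLike.re_le_norm _)
  obtain ⟨B, hB⟩ := hunit.exists_right_inv
  refine ⟨B, fun z v => ?_⟩
  have hBz : rieszOp P.a (B z) = z := congrArg (fun A : H →L[𝕜] H => A z) hB
  rw [← inner_rieszOp, hBz]

end Energy

section DenseSequence

variable [CompleteSpace H] {X : ℕ → Submodule 𝕜 H}

theorem eq_zero_of_weakTendsto (hX : Monotone X)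
    (hd : closure (⋃ n, (X n : Set H)) = Set.univ) {x : ℕ → H} {w : H}
    (hw : WeakTendsto 𝕜 x (hyperfilter ℕ : Filter ℕ) w)
    (hx : ∀ n, ∀ v ∈ X n, ‖P.b (x n) v‖ ≤ 1 / ((n : ℝ) + 1) * ‖v‖) : w = 0 := by
  have hunion : (⋃ n, (X n : Set H)) ⊆ {v : H | P.b w v = 0} := by
    intro v hv
    obtain ⟨k, hk⟩ := Set.mem_iUnion.1 hv
    have hweak : Tendsto (fun n => P.b (x n) v) (hyperfilter ℕ : Filter ℕ) (𝓝 (P.b w v)) :=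
      hw.functional (P.b.flip v : H →L[𝕜] 𝕜)
    have hzero : Tendsto (fun n => P.b (x n) v) atTop (𝓝 0) := by
      have hbound : Tendsto (fun n : ℕ => 1 / ((n : ℝ) + 1) * ‖v‖) atTop (𝓝 0) := by
        simpa using tendsto_one_div_add_atTop_nhds_zero_nat.mul_const ‖v‖
      refine squeeze_zero_norm' ?_ hbound
      filter_upwards [eventually_ge_atTop k] with n hn using hx n v (hX hn hk)
    exact tendsto_nhds_unique hweak (hzero.mono_left Nat.hyperfilter_le_atTop)
  refine (P.wellPosed w).2 fun v => ?_
  exact closure_minimal hunion (isClosed_eq (P.b w).continuous continuous_const)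
    (hd ▸ Set.mem_univ v)

-- Otherwise normalized counterexamples have a weak limit `w` with `b w = 0`, that is `w = 0`, and
-- compactness turns this into `K xₙ → 0`.
theorem exists_norm_K_le (hX : Monotone X) (hd : closure (⋃ n, (X n : Set H)) = Set.univ) {δ : ℝ}
    (hδ : 0 < δ) : ∃ (N : ℕ) (ρ : ℝ), 0 < ρ ∧ ∀ w : H, ‖w‖ = 1 →
      (∀ v ∈ X N, ‖P.b w v‖ ≤ ρ * ‖v‖) → ‖P.K w‖ ≤ δ := by
  by_contra! hcon
  choose x hx hxb hxK using fun n : ℕ => hcon n (1 / ((n : ℝ) + 1)) (by positivity)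
  obtain ⟨w, hw⟩ := exists_weakTendsto (𝕜 := 𝕜) (hyperfilter ℕ) fun n => (hx n).le
  obtain rfl := P.eq_zero_of_weakTendsto hX hd hw hxb
  have hK := (hw.tendsto_of_isCompactOperator (fun n => (hx n).le) P.compact).norm
  rw [map_zero, norm_zero] at hK
  exact hδ.not_ge (ge_of_tendsto' hK fun n => (hxK n).le)

theorem exists_norm_K_le_mul_norm (hX : Monotone X)
    (hd : closure (⋃ n, (X n : Set H)) = Set.univ) {δ : ℝ} (hδ : 0 < δ) :
    ∃ N : ℕ, ∀ w : H, (∀ v ∈ X N, P.b w v = 0) → ‖P.K w‖ ≤ δ * ‖w‖ := by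
  obtain ⟨N, ρ, hρ, hN⟩ := P.exists_norm_K_le hX hd hδ
  refine ⟨N, fun w hw => ?_⟩
  rcases eq_or_ne w 0 with rfl | hw0
  · simp
  have hunit := hN ((‖w‖ : 𝕜)⁻¹ • w) (norm_smul_inv_norm hw0) fun v hv => by
    rw [map_smul, smul_apply, hw v hv, smul_zero, norm_zero]
    positivity
  rw [map_smul, norm_smul, norm_inv, RCLike.norm_ofReal, abs_norm,
    inv_mul_le_iff₀ (norm_pos_iff.2 hw0), mul_comm] at hunit
  exact hunit

theorem exists_le_infSup (hX : Monotone X) (hd : closure (⋃ n, (X n : Set H)) = Set.univ) :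
    ∃ (N : ℕ) (γ : ℝ), 0 < γ ∧ ∀ V : Submodule 𝕜 H, X N ≤ V → ENNReal.ofReal γ ≤ P.infSup V := by
  obtain ⟨α, hα, hell⟩ := P.elliptic
  obtain ⟨N, ρ, hρ, hN⟩ := P.exists_norm_K_le hX hd (half_pos hα)
  refine ⟨N, min ρ (α / 4), by positivity, fun V hV => ?_⟩
  by_contra! hlt
  obtain ⟨W, hW, hW1, hb⟩ := P.exists_unit_of_infSup_lt hlt
  have hK : ‖P.K W W‖ ≤ α / 2 := by
    simpa [hW1] using (P.K W).le_of_opNorm_le (hN W hW1 fun v hv =>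
      (hb v (hV hv)).trans (by gcongr; exact min_le_left _ _)) W
  have hbW : ‖P.b W W‖ ≤ α / 4 :=
    (hb W hW).trans (by rw [hW1, mul_one]; exact min_le_right _ _)
  have ha : α ≤ ‖P.b W W - P.K W W‖ := by
    rw [b_apply, add_sub_cancel_right]
    simpa [hW1] using (hell W).trans (RCLike.re_le_norm _)
  linarith [norm_sub_le (P.b W W) (P.K W W)]

theorem exists_quasiOrthogonal (hX : Monotone X) (hd : closure (⋃ n, (X n : Set H)) = Set.univ)
    {ε : ℝ} (hε : 0 < ε) (hε' : ε < 1) :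
    ∃ N : ℕ, ∀ V V' : Submodule 𝕜 H, X N ≤ V → V ≤ V' → P.Solvable V → P.Solvable V' →
      P.energySq (P.u - P.galerkin V') + P.energySq (P.galerkin V' - P.galerkin V) ≤
        1 / (1 - ε) * P.energySq (P.u - P.galerkin V) := by
  obtain ⟨α, hα, hell⟩ := P.elliptic
  obtain ⟨N, hN⟩ := P.exists_norm_K_le_mul_norm hX hd (mul_pos hε hα)
  refine ⟨N, fun V V' hV hVV' hs hs' => ?_⟩
  set e := P.u - P.galerkin V'
  set d := P.galerkin V' - P.galerkin V
  have hd' : d ∈ V' := V'.sub_mem (P.isGalerkinSolution_galerkin hs').1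
    (hVV' (P.isGalerkinSolution_galerkin hs).1)
  have horth : ∀ v ∈ V', P.b e v = 0 := fun v hv => P.b_sub_galerkin_eq_zero hs' hv
  have hK : ‖P.K e‖ ≤ ε * α * ‖e‖ := hN e fun v hv => horth v (hVV' (hV hv))
  have hcross : |RCLike.re (P.a e d)| ≤ ε * α * ‖e‖ * ‖d‖ := by
    rw [eq_neg_of_add_eq_zero_left ((P.b_apply e d).symm.trans (horth d hd')), map_neg, abs_neg]
    exact (RCLike.abs_re_le_norm _).trans ((P.K e).le_of_opNorm_le hK d)
  rw [← sub_add_sub_cancel P.u (P.galerkin V') (P.galerkin V), energySq_add, one_div,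
    ← div_eq_inv_mul, le_div_iff₀ (by linarith)]
  have hyoung : 0 ≤ ε * α * (‖e‖ - ‖d‖) ^ 2 := by positivity
  have hsum : ε * (α * ‖e‖ ^ 2 + α * ‖d‖ ^ 2) ≤ ε * (P.energySq e + P.energySq d) := by
    gcongr
    exacts [hell e, hell d]
  nlinarith [(abs_le.1 hcross).1]

end DenseSequence

section InfSupTransfer

variable {γ : ℝ}

theorem mul_sq_norm_le_energySq_add (hb : ∀ w, γ * ‖w‖ ≤ ‖P.b w‖) (hγ : 0 < γ) {B : H →L[𝕜] H}
    (hB : ∀ z v, P.a (B z) v = inner 𝕜 v z) (y : H) :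
    γ * ‖y‖ ^ 2 ≤ P.energySq y + γ * (‖P.K (B y)‖ * ‖y‖) := by
  have ha : ‖P.a (B y)‖ ≤ ‖y‖ := ContinuousLinearMap.opNorm_le_bound _ (norm_nonneg _) fun v => by
    rw [hB, mul_comm]
    exact norm_inner_le_norm _ _
  have hBy : γ * ‖B y‖ ≤ ‖y‖ + ‖P.K (B y)‖ :=
    (hb _).trans ((norm_add_le (P.a (B y)) (P.K (B y))).trans (by gcongr))
  have hBB : P.energySq (B y) ≤ ‖B y‖ * ‖y‖ := by
    rw [energySq, hB]
    exact (RCLike.re_le_norm _).trans (norm_inner_le_norm _ _)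
  have hexpand : P.energySq (y + ((-γ : ℝ) : 𝕜) • B y) =
      P.energySq y + γ ^ 2 * P.energySq (B y) - 2 * (γ * ‖y‖ ^ 2) := by
    rw [energySq_add, energySq_smul, P.hermitian, RCLike.conj_re, map_smul, smul_apply, hB,
      smul_eq_mul, RCLike.re_ofReal_mul, inner_self_eq_norm_sq]
    ring
  have hγBB : γ ^ 2 * P.energySq (B y) ≤ γ * ‖y‖ ^ 2 + γ * (‖P.K (B y)‖ * ‖y‖) := by
    calc γ ^ 2 * P.energySq (B y) ≤ γ ^ 2 * (‖B y‖ * ‖y‖) := by gcongr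
      _ = γ * ((γ * ‖B y‖) * ‖y‖) := by ring
      _ ≤ γ * ((‖y‖ + ‖P.K (B y)‖) * ‖y‖) := by gcongr
      _ = _ := by ring
  linarith [P.energySq_nonneg (y + ((-γ : ℝ) : 𝕜) • B y)]

variable [CompleteSpace H] {ι : Type*} {l : Ultrafilter ι} {y : ι → H} {C Y A : ℝ}

-- The compact part disappears on weakly null families, where the inf-sup constant of `b` becomes a
-- lower bound for the principal part `a`.
theorem mul_le_of_tendsto_energySq (hb : ∀ w, γ * ‖w‖ ≤ ‖P.b w‖) (hγ : 0 < γ)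
    (hC : ∀ i, ‖y i‖ ≤ C) (hy : WeakTendsto 𝕜 y l 0) (hY : Tendsto (fun i => ‖y i‖ ^ 2) l (𝓝 Y))
    (hA : Tendsto (fun i => P.energySq (y i)) l (𝓝 A)) : γ * Y ≤ A := by
  obtain ⟨B, hB⟩ := P.exists_a_apply_eq_inner
  have hBy : WeakTendsto 𝕜 (fun i => B (y i)) l 0 := by simpa using hy.map B
  have hK : Tendsto (fun i => ‖P.K (B (y i))‖) l (𝓝 0) := by
    simpa using (hBy.tendsto_of_isCompactOperator (fun i => B.le_opNorm_of_le (hC i))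
      P.compact).norm
  have hlim : Tendsto (fun i => P.energySq (y i) + γ * (‖P.K (B (y i))‖ * C)) l (𝓝 A) := by
    simpa using hA.add ((hK.mul_const C).const_mul γ)
  refine le_of_tendsto_of_tendsto' (hY.const_mul γ) hlim fun i => ?_
  exact (P.mul_sq_norm_le_energySq_add hb hγ hB _).trans (by gcongr; exact hC i)

theorem tendsto_re_b_add (hC : ∀ i, ‖y i‖ ≤ C) (hy : WeakTendsto 𝕜 y l 0)
    (hA : Tendsto (fun i => P.energySq (y i)) l (𝓝 A)) {p q : ι → H} {w z : H}
    (hp : Tendsto p l (𝓝 w)) (hq : Tendsto q l (𝓝 z)) (t : ℝ) :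
    Tendsto (fun i => RCLike.re (P.b (p i + y i) (q i + (t : 𝕜) • y i))) l
      (𝓝 (RCLike.re (P.b w z) + t * A)) := by
  have hre : Continuous (RCLike.re : 𝕜 → ℝ) := RCLike.continuous_re
  have hpq : Tendsto (fun i => P.b (p i) (q i)) l (𝓝 (P.b w z)) := by
    simpa only [Function.comp_def, inner_rieszOp] using
      Tendsto.inner (𝕜 := 𝕜) hq (((rieszOp P.b).continuous.tendsto w).comp hp)
  have hyq : Tendsto (fun i => P.b (y i) (q i)) l (𝓝 0) := by
    simpa using hy.tendsto_form_left hC hq P.b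
  have hpy : Tendsto (fun i => P.b (p i) (y i)) l (𝓝 0) := by
    simpa using hy.tendsto_form_right hC hp P.b
  have hKyy : Tendsto (fun i => P.K (y i) (y i)) l (𝓝 0) := by
    refine squeeze_zero_norm (fun i => (P.K (y i)).le_opNorm_of_le (hC i)) ?_
    simpa using (hy.tendsto_of_isCompactOperator hC P.compact).norm.mul_const C
  have hre_of {c : ι → 𝕜} {s : 𝕜} (h : Tendsto c l (𝓝 s)) :
      Tendsto (fun i => RCLike.re (c i)) l (𝓝 (RCLike.re s)) := (hre.tendsto s).comp h
  have hsum := ((hre_of hpq).add (hre_of hyq)).add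
    (((hre_of hpy).add (hA.add (hre_of hKyy))).const_mul t)
  simp only [map_zero, add_zero, zero_add] at hsum
  refine hsum.congr fun i => ?_
  simp only [energySq, b_apply, map_add, add_apply, ContinuousLinearMap.map_smulₛₗ,
    RCLike.conj_ofReal, smul_eq_mul, RCLike.re_ofReal_mul]
  ring

theorem le_of_inf_sup_limit {γ γ' r g Y A : ℝ} (hγ : 0 < γ) (hr : r ^ 2 + Y = 1)
    (hrg : γ * r ≤ g) (hr0 : 0 ≤ r) (hYA : γ * Y ≤ A)
    (h : g ^ 2 + γ * A ≤ γ' * √(g ^ 2 + γ ^ 2 * Y)) : γ ≤ γ' := by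
  set S := g ^ 2 + γ ^ 2 * Y
  have hγS : γ ^ 2 ≤ S := by
    calc γ ^ 2 = (γ * r) ^ 2 + γ ^ 2 * Y := by rw [mul_pow, ← mul_add, hr, mul_one]
      _ ≤ S := add_le_add_left (by gcongr) _
  have hSS : √S * √S ≤ γ' * √S := by
    rw [Real.mul_self_sqrt ((sq_nonneg γ).trans hγS)]
    exact le_trans (by nlinarith) h
  have hγr : γ ≤ √S := Real.le_sqrt_of_sq_le hγS
  exact hγr.trans (le_of_mul_le_mul_right hSS (hγ.trans_le hγr))

-- With the weak limit `w` of `W n` and the Riesz representation `g` of `b w`, the test functions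
-- are `Π g + γ (W n - Π w)`, where `Π` is the orthogonal projection onto `X n`.
theorem le_of_forall_exists_unit {X V : ℕ → Submodule 𝕜 H}
    [∀ n, (X n).HasOrthogonalProjection] (hX : Monotone X)
    (hd : closure (⋃ n, (X n : Set H)) = Set.univ) (hb : ∀ w, γ * ‖w‖ ≤ ‖P.b w‖) (hγ : 0 < γ)
    {γ' : ℝ} (hXV : ∀ n, X n ≤ V n) {W : ℕ → H} (hWV : ∀ n, W n ∈ V n)
    (hW : ∀ n, ‖W n‖ = 1) (hWb : ∀ n, ∀ v ∈ V n, ‖P.b (W n) v‖ ≤ γ' * ‖v‖) : γ ≤ γ' := by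
  let l : Ultrafilter ℕ := hyperfilter ℕ
  have hproj (z : H) : Tendsto (fun n => (X n).starProjection z) l (𝓝 z) := by
    refine (Submodule.starProjection_tendsto_self X hX z ?_).mono_left Nat.hyperfilter_le_atTop
    rw [← SetLike.coe_subset_coe, Submodule.topologicalClosure_coe,
      Submodule.coe_iSup_of_directed X hX.directed_le, hd]
    exact Set.subset_univ _
  obtain ⟨w, hw⟩ := exists_weakTendsto (𝕜 := 𝕜) l fun n => (hW n).le
  let g := rieszOp P.b w
  let y : ℕ → H := fun n => W n - (X n).starProjection w
  have hy : WeakTendsto 𝕜 y l 0 := by simpa using hw.sub (.of_tendsto (hproj w))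
  have hyC : ∀ n, ‖y n‖ ≤ 1 + ‖w‖ := fun n =>
    (norm_sub_le _ _).trans (add_le_add (hW n).le ((X n).norm_starProjection_apply_le w))
  obtain ⟨Y, hY⟩ := exists_tendsto_of_mem_compact (isCompact_Icc (a := 0) (b := (1 + ‖w‖) ^ 2)) l
    (x := fun n => ‖y n‖ ^ 2) fun n => ⟨sq_nonneg _, by gcongr; exact hyC n⟩
  obtain ⟨A, hA⟩ := exists_tendsto_of_mem_compact
    (isCompact_Icc (a := 0) (b := ‖P.a‖ * (1 + ‖w‖) ^ 2)) l (x := fun n => P.energySq (y n))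
    fun n => ⟨P.energySq_nonneg _, (P.energySq_le _).trans (by gcongr; exact hyC n)⟩
  have hWy : ∀ n, (X n).starProjection w + y n = W n := fun n => add_sub_cancel _ _
  have hnorm : ‖w‖ ^ 2 + Y = 1 := by
    simpa [hWy, hW, eq_comm] using hy.tendsto_norm_add_smul_sq hyC (hproj w) hY 1
  let v : ℕ → H := fun n => (X n).starProjection g + (γ : 𝕜) • y n
  have hvV : ∀ n, v n ∈ V n := fun n =>
    (V n).add_mem (hXV n ((X n).starProjection_apply_mem g)) <|
      (V n).smul_mem _ ((V n).sub_mem (hWV n) (hXV n ((X n).starProjection_apply_mem w)))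
  have hbv : Tendsto (fun n => RCLike.re (P.b (W n) (v n))) l (𝓝 (‖g‖ ^ 2 + γ * A)) := by
    rw [← inner_self_eq_norm_sq (𝕜 := 𝕜), inner_rieszOp]
    simpa only [hWy] using P.tendsto_re_b_add hyC hy hA (hproj w) (hproj g) γ
  have hvnorm := hy.tendsto_norm_add_smul_sq hyC (hproj g) hY γ
  refine le_of_inf_sup_limit hγ hnorm ((hb w).trans (norm_apply_le_norm_rieszOp P.b w))
    (norm_nonneg w) (P.mul_le_of_tendsto_energySq hb hγ hyC hy hY hA) <|
    le_of_tendsto_of_tendsto' hbv (hvnorm.sqrt.const_mul γ') fun n => ?_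
  rw [Real.sqrt_sq (norm_nonneg _)]
  exact (RCLike.re_le_norm _).trans (hWb n _ (hvV n))

theorem exists_ofReal_le_infSup {F : Submodule 𝕜 H} [FiniteDimensional 𝕜 F] {γ' : ℝ}
    (hγ : 0 < γ) (hγ' : γ' < γ)
    (hF : ∀ V : Submodule 𝕜 H, FiniteDimensional 𝕜 V → F ≤ V → ENNReal.ofReal γ ≤ P.infSup V)
    {X : ℕ → Submodule 𝕜 H} [∀ n, (X n).HasOrthogonalProjection] (hX : Monotone X)
    (hd : closure (⋃ n, (X n : Set H)) = Set.univ) :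
    ∃ N : ℕ, ∀ V : Submodule 𝕜 H, X N ≤ V → ENNReal.ofReal γ' ≤ P.infSup V := by
  by_contra! hcon
  choose V hXV hlt using hcon
  choose W hWV hW hWb using fun n => P.exists_unit_of_infSup_lt (hlt n)
  exact hγ'.not_ge <| P.le_of_forall_exists_unit hX hd (P.mul_norm_le_norm_b hF) hγ
    hXV hWV hW hWb

end InfSupTransfer

end Problem

section Meshes

variable {d : ℕ} {Ω : Set (EuclideanSpace ℝ (Fin d))}

namespace Triangulation

variable {T T' T'' : Triangulation Ω} {E E' F : Set (EuclideanSpace ℝ (Fin d))}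

theorem mem_sons : E' ∈ T.sons E ↔ E' ∈ T.elems ∧ E' ⊆ E := by
  simp only [sons, Finset.mem_filter]

theorem mem_sdiff : E ∈ T.sdiff T' ↔ E ∈ T.elems ∧ E ∉ T'.elems := by
  simp only [sdiff, Finset.mem_sdiff]

theorem eq_of_subset_of_subset (hE : E ∈ T.elems) (hE' : E' ∈ T.elems) (hF : 0 < volume F)
    (hFE : F ⊆ E) (hFE' : F ⊆ E') : E = E' := by
  by_contra hne
  exact hF.not_ge ((measure_mono (Set.subset_inter hFE hFE')).trans_eq (T.overlap E hE E' hE' hne))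

theorem sons_of_mem (hE : E ∈ T.elems) : T.sons E = {E} := by
  ext F
  rw [mem_sons, Finset.mem_singleton]
  constructor
  · rintro ⟨hF, hFE⟩
    exact eq_of_subset_of_subset hF hE (T.volume_pos F hF) subset_rfl hFE
  · rintro rfl
    exact ⟨hE, subset_rfl⟩

theorem pairwiseDisjoint_sons :
    Set.PairwiseDisjoint (T.elems : Set (Set (EuclideanSpace ℝ (Fin d)))) T'.sons := by
  intro E hE E' hE' hne
  rw [Function.onFun, Finset.disjoint_left]
  intro F hF hF'
  exact hne (eq_of_subset_of_subset hE hE' (T'.volume_pos F (mem_sons.1 hF).1)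
    (mem_sons.1 hF).2 (mem_sons.1 hF').2)

namespace Subdivides

protected theorem rfl : T.Subdivides T := fun E hE => by
  simp only [sons_of_mem hE, Finset.mem_singleton, Set.iUnion_iUnion_eq_left]

theorem trans (h : T'.Subdivides T) (h' : T''.Subdivides T') : T''.Subdivides T := by
  refine fun E hE => Set.Subset.antisymm (fun x hx => ?_) <|
    Set.iUnion₂_subset fun E' hE' => (mem_sons.1 hE').2
  rw [h E hE] at hx
  obtain ⟨E', hE', hx⟩ := Set.mem_iUnion₂.1 hx
  rw [h' E' (mem_sons.1 hE').1] at hx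
  obtain ⟨E'', hE'', hx⟩ := Set.mem_iUnion₂.1 hx
  exact Set.mem_iUnion₂.2 ⟨E'', mem_sons.2 ⟨(mem_sons.1 hE'').1,
    (mem_sons.1 hE'').2.trans (mem_sons.1 hE').2⟩, hx⟩

-- An element contained in no element of `T` would be covered by its null intersections with the
-- other elements of `T'`.
theorem exists_superset (h : T'.Subdivides T) (hF : F ∈ T'.elems) : ∃ E ∈ T.elems, F ⊆ E := by
  classical
  by_contra! hnot
  have hcov : F ⊆ ⋃ G ∈ T'.elems.erase F, F ∩ G := by
    intro x hx
    have hxT : x ∈ ⋃ E ∈ T.elems, E := by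
      rw [T.cover, ← T'.cover]
      exact Set.mem_iUnion₂.2 ⟨F, hF, hx⟩
    obtain ⟨E, hE, hxE⟩ := Set.mem_iUnion₂.1 hxT
    rw [h E hE] at hxE
    obtain ⟨G, hG, hxG⟩ := Set.mem_iUnion₂.1 hxE
    refine Set.mem_iUnion₂.2 ⟨G, Finset.mem_erase.2 ⟨?_, (mem_sons.1 hG).1⟩, hx, hxG⟩
    rintro rfl
    exact hnot E hE (mem_sons.1 hG).2
  have hnull : volume (⋃ G ∈ T'.elems.erase F, F ∩ G) = 0 := by
    refine (measure_biUnion_null_iff (Finset.countable_toSet _)).2 fun G hG => ?_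
    obtain ⟨hne, hG⟩ := Finset.mem_erase.1 hG
    exact T'.overlap F hF G hG hne.symm
  exact (T'.volume_pos F hF).ne' (measure_mono_null hcov hnull)

open Classical in
theorem biUnion_sons (h : T'.Subdivides T) : T.elems.biUnion T'.sons = T'.elems := by
  ext F
  simp only [Finset.mem_biUnion, mem_sons]
  constructor
  · rintro ⟨E, -, hF, -⟩
    exact hF
  · intro hF
    obtain ⟨E, hE, hFE⟩ := h.exists_superset hF
    exact ⟨E, hE, hF, hFE⟩

theorem card_eq_sum (h : T'.Subdivides T) : T'.card = ∑ E ∈ T.elems, (T'.sons E).card := by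
  classical
  rw [card, ← h.biUnion_sons, Finset.card_biUnion pairwiseDisjoint_sons]

theorem sons_nonempty (h : T'.Subdivides T) (hE : E ∈ T.elems) : (T'.sons E).Nonempty := by
  by_contra! hempty
  have hvol := T.volume_pos E hE
  rw [h E hE, hempty] at hvol
  simp at hvol

theorem two_le_card_sons (h : T'.Subdivides T) (hE : E ∈ T.elems) (hE' : E ∉ T'.elems) :
    2 ≤ (T'.sons E).card := by
  by_contra! hlt
  obtain ⟨F, hF⟩ := Finset.card_eq_one.1 <|
    le_antisymm (Nat.lt_succ_iff.1 hlt) (h.sons_nonempty hE).card_pos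
  have hEF : E = F := by
    rw [h E hE, hF]
    simp
  have hFsons : F ∈ T'.sons E := hF ▸ Finset.mem_singleton_self F
  exact hE' (hEF ▸ (mem_sons.1 hFsons).1)

theorem card_add_card_sdiff_le (h : T'.Subdivides T) : T.card + (T.sdiff T').card ≤ T'.card := by
  classical
  rw [h.card_eq_sum, card, Finset.card_eq_sum_ones, sdiff, Finset.card_eq_sum_ones,
    ← Finset.filter_notMem_eq_sdiff, Finset.sum_filter, ← Finset.sum_add_distrib]
  refine Finset.sum_le_sum fun E hE => ?_
  split_ifs with hE'
  · exact (h.sons_nonempty hE).card_pos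
  · exact h.two_le_card_sons hE hE'

end Subdivides

end Triangulation

namespace RefinementStrategy

variable {S : RefinementStrategy Ω} {T T' : Triangulation Ω}

theorem refines_refine {M : Finset (Set (EuclideanSpace ℝ (Fin d)))} (hM : M ⊆ T.elems) :
    S.Refines T (S.refine T M) := Relation.ReflTransGen.single ⟨M, hM, rfl⟩

theorem Refines.conforming (h : S.Refines T T') (hT : S.Conforming T) : S.Conforming T' := by
  induction h with
  | refl => exact hT
  | tail _ hstep ih =>
    obtain ⟨M, hM, rfl⟩ := hstep
    exact S.conforming_refine _ M ih hM

theorem Refines.subdivides (h : S.Refines T T') (hT : S.Conforming T) : T'.Subdivides T := by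
  induction h with
  | refl => exact Triangulation.Subdivides.rfl
  | tail h hstep ih =>
    obtain ⟨M, hM, rfl⟩ := hstep
    exact ih.trans (S.subdivides_refine _ M (Refines.conforming h hT) hM)

end RefinementStrategy

namespace Discretization

variable {𝕜 : Type*} [RCLike 𝕜] {H : Type*} [NormedAddCommGroup H] [InnerProductSpace 𝕜 H]
  {P : Problem 𝕜 H} {D : Discretization 𝕜 H Ω} {T T' : Triangulation Ω}

namespace Admissible

theorem conforming (h : D.Admissible T) : D.S.Conforming T :=
  RefinementStrategy.Refines.conforming h D.conforming_T0

theorem trans (h : D.Admissible T) (h' : D.S.Refines T T') : D.Admissible T' :=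
  Relation.ReflTransGen.trans h h'

theorem card_add_card_sdiff_le (h : D.Admissible T) (h' : D.S.Refines T T') :
    T.card + (T.sdiff T').card ≤ T'.card :=
  (h'.subdivides h.conforming).card_add_card_sdiff_le

theorem card_le (h : D.Admissible T) (h' : D.S.Refines T T') : T.card ≤ T'.card :=
  (Nat.le_add_right _ _).trans (h.card_add_card_sdiff_le h')

theorem solvable [CompleteSpace H] (h : D.Admissible T) (hpos : 0 < P.infSup (D.X T)) :
    D.Solvable P T :=
  have := D.finiteDimensional T h
  P.solvable_of_infSup_pos hpos

end Admissible

theorem SonBounds.card_refine_le {Cson : ℕ} (hsons : D.SonBounds Cson) (h : D.Admissible T)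
    {M : Finset (Set (EuclideanSpace ℝ (Fin d)))} (hM : M ⊆ T.elems) :
    (D.S.refine T M).card ≤ (Cson + 1) * T.card := by
  rw [(D.S.subdivides_refine T M h.conforming hM).card_eq_sum, Triangulation.card, mul_comm,
    ← smul_eq_mul]
  refine Finset.sum_le_card_nsmul _ _ _ fun E hE => ?_
  by_cases hE' : E ∈ (D.S.refine T M).elems
  · rw [Triangulation.sons_of_mem hE', Finset.card_singleton]
    exact Nat.le_add_left 1 Cson
  · exact (hsons T M h hM E (Triangulation.mem_sdiff.2 ⟨hE, hE'⟩)).2.trans (Nat.le_succ _)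

theorem uniform_succ (m : ℕ) :
    D.uniform (m + 1) = D.S.refine (D.uniform m) (D.uniform m).elems := by
  rw [uniform, Function.iterate_succ_apply']
  rfl

theorem refines_uniform_succ (m : ℕ) : D.S.Refines (D.uniform m) (D.uniform (m + 1)) := by
  rw [uniform_succ]
  exact RefinementStrategy.refines_refine subset_rfl

theorem admissible_uniform (m : ℕ) : D.Admissible (D.uniform m) := by
  induction m with
  | zero => exact Relation.ReflTransGen.refl
  | succ m ih => exact ih.trans (refines_uniform_succ m)

theorem monotone_X_uniform : Monotone fun m => D.X (D.uniform m) :=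
  monotone_nat_of_le_succ fun m => D.nested _ _ (admissible_uniform m) (refines_uniform_succ m)

theorem dense_uniform : closure (⋃ m, (D.X (D.uniform m) : Set H)) = Set.univ :=
  D.dense D.uniform (fun m => (D.uniform m).elems) rfl (fun _ => subset_rfl) uniform_succ
    (by simpa using Set.infinite_univ)

end Discretization

namespace AdaptiveRun

variable {𝕜 : Type*} [RCLike 𝕜] {H : Type*} [NormedAddCommGroup H] [InnerProductSpace 𝕜 H]
  {P : Problem 𝕜 H} {D : Discretization 𝕜 H Ω} {θ Cmark : ℝ} (r : AdaptiveRun P D θ Cmark)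

theorem refines_succ (l : ℕ) : D.S.Refines (r.mesh l) (r.mesh (l + 1)) := by
  rw [r.mesh_succ]
  exact RefinementStrategy.refines_refine (r.marked_subset l)

theorem refines_of_le {k l : ℕ} (h : k ≤ l) : D.S.Refines (r.mesh k) (r.mesh l) := by
  induction l, h using Nat.le_induction with
  | base => exact Relation.ReflTransGen.refl
  | succ l _ ih => exact ih.trans (r.refines_succ l)

theorem admissible (l : ℕ) : D.Admissible (r.mesh l) := by
  simpa only [Discretization.Admissible, r.mesh_zero] using r.refines_of_le (Nat.zero_le l)

theorem monotone_X : Monotone fun l => D.X (r.mesh l) := fun _ _ h =>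
  D.nested _ _ (r.admissible _) (r.refines_of_le h)

theorem marked_subset_sdiff (l : ℕ) : r.marked l ⊆ (r.mesh l).sdiff (r.mesh (l + 1)) := by
  rw [r.mesh_succ]
  exact D.S.marked_refined _ _ (r.admissible l).conforming (r.marked_subset l)

theorem card_add_card_marked_le (l : ℕ) :
    (r.mesh l).card + (r.marked l).card ≤ (r.mesh (l + 1)).card :=
  (Nat.add_le_add_left (Finset.card_le_card (r.marked_subset_sdiff l)) _).trans
    ((r.admissible l).card_add_card_sdiff_le (r.refines_succ l))

theorem sum_card_marked_le (l : ℕ) :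
    D.T0.card + ∑ j ∈ Finset.range l, (r.marked j).card ≤ (r.mesh l).card := by
  induction l with
  | zero => simp [r.mesh_zero]
  | succ l ih =>
    rw [Finset.sum_range_succ]
    linarith [r.card_add_card_marked_le l]

theorem U_of_solvable {l : ℕ} (h : D.Solvable P (r.mesh l)) : r.U l = D.sol P (r.mesh l) := by
  cases l <;> simp [U, h]

theorem est_of_solvable {l : ℕ} (h : D.Solvable P (r.mesh l)) : r.est l = D.eta (r.mesh l) := by
  cases l <;> simp [est, h]

variable [CompleteSpace H]

theorem eventually_solvable (hr : r.limitSpace = Set.univ) :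
    ∀ᶠ l in atTop, D.Solvable P (r.mesh l) := by
  obtain ⟨N, γ, hγ, hN⟩ := P.exists_le_infSup r.monotone_X hr
  filter_upwards [eventually_ge_atTop N] with l hl
  exact (r.admissible l).solvable ((ENNReal.ofReal_pos.2 hγ).trans_le (hN _ (r.monotone_X hl)))

theorem exists_quasiOrthogonalFrom (hr : r.limitSpace = Set.univ) {ε : ℝ} (hε : 0 < ε)
    (hε' : ε < 1) : ∃ l₃, r.QuasiOrthogonalFrom ε l₃ := by
  obtain ⟨N, hN⟩ := P.exists_quasiOrthogonal r.monotone_X hr hε hε'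
  obtain ⟨N', hN'⟩ := eventually_atTop.1 (r.eventually_solvable hr)
  refine ⟨max N N', fun l hl => ?_⟩
  have hs := hN' l ((le_max_right _ _).trans hl)
  have hs' := hN' (l + 1) (((le_max_right _ _).trans hl).trans (Nat.le_succ l))
  rw [r.U_of_solvable hs, r.U_of_solvable hs']
  exact hN _ _ (r.monotone_X ((le_max_left _ _).trans hl)) (r.monotone_X (Nat.le_succ l)) hs hs'

end AdaptiveRun

end Meshes

section Estimator

variable {d : ℕ} {Ω : Set (EuclideanSpace ℝ (Fin d))}
  {𝕜 : Type*} [RCLike 𝕜] {H : Type*} [NormedAddCommGroup H] [InnerProductSpace 𝕜 H]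

theorem Triangulation.inter_comm (T T' : Triangulation Ω) : T.inter T' = T'.inter T := by
  classical
  rw [inter, inter, Finset.inter_comm]

theorem sq_le_of_abs_sub_le {x y c δ : ℝ} (hδ : 0 < δ) (h : |x - y| ≤ c) :
    x ^ 2 ≤ (1 + δ) * y ^ 2 + (1 + δ⁻¹) * c ^ 2 := by
  have hsq : (x - y) ^ 2 ≤ c ^ 2 := sq_le_sq.2 (h.trans (le_abs_self c))
  calc x ^ 2 ≤ x ^ 2 + δ⁻¹ * (δ * y - (x - y)) ^ 2 := le_add_of_nonneg_right (by positivity)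
    _ = (1 + δ) * y ^ 2 + (1 + δ⁻¹) * (x - y) ^ 2 := by
      field_simp
      ring
    _ ≤ _ := by gcongr

namespace Discretization

section Local

variable {D : Discretization 𝕜 H Ω} {T : Triangulation Ω}
  {A B : Finset (Set (EuclideanSpace ℝ (Fin d)))}

theorem etaOn_nonneg : 0 ≤ D.etaOn T A := Real.sqrt_nonneg _

theorem eta_nonneg : 0 ≤ D.eta T := etaOn_nonneg

theorem etaOn_sq : D.etaOn T A ^ 2 = ∑ E ∈ A, D.η T E ^ 2 :=
  Real.sq_sqrt (Finset.sum_nonneg fun _ _ => sq_nonneg _)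

theorem etaOn_mono (h : A ⊆ B) : D.etaOn T A ≤ D.etaOn T B :=
  Real.sqrt_le_sqrt (Finset.sum_le_sum_of_subset_of_nonneg h fun _ _ _ => sq_nonneg _)

theorem eta_sq_eq_inter_add_sdiff (T' : Triangulation Ω) :
    D.eta T ^ 2 = D.etaOn T (T.inter T') ^ 2 + D.etaOn T (T.sdiff T') ^ 2 := by
  classical
  rw [eta, etaOn_sq, etaOn_sq, etaOn_sq, Triangulation.inter, Triangulation.sdiff,
    Finset.sum_inter_add_sum_sdiff]

end Local

variable {P : Problem 𝕜 H} {D : Discretization 𝕜 H Ω}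
  {Cstb Cred qred Crel γ θ : ℝ} {T T' That : Triangulation Ω}

theorem Stability.eta_sq_le {δ : ℝ} (hA1 : D.Stability P Cstb) (hA2 : D.Reduction P Cred qred)
    (hT : D.Admissible T) (hT' : D.S.Refines T T') (hs : D.Solvable P T) (hs' : D.Solvable P T')
    (hδ : 0 < δ) :
    D.eta T' ^ 2 ≤ (1 + δ) * D.etaOn T (T.inter T') ^ 2 + qred * D.etaOn T (T.sdiff T') ^ 2 +
      ((1 + δ⁻¹) * Cstb ^ 2 + Cred ^ 2) * ‖D.sol P T' - D.sol P T‖ ^ 2 := by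
  have hcommon := sq_le_of_abs_sub_le hδ (hA1 T T' hT hT' hs hs')
  have hrefined := hA2 T T' hT hT' hs hs'
  rw [eta_sq_eq_inter_add_sdiff T, T.inter_comm]
  rw [mul_pow] at hcommon
  linarith

/-- Quasi-monotonicity of the estimator, for the passage from arbitrary meshes to refinements of
`That`. -/
def QuasiMonotone (P : Problem 𝕜 H) (D : Discretization 𝕜 H Ω) (That : Triangulation Ω)
    (C : ℝ) : Prop :=
  ∀ T T', D.Admissible T → D.Solvable P T → D.S.Refines T T' → D.S.Refines That T' →
    D.eta T' ≤ C * D.eta T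

/-- Optimality of the Dörfler criterion: if a refinement reduces the estimator by the factor `κ`,
then the number of refined elements controls the size of some set satisfying the criterion. -/
def DoerflerOptimal (D : Discretization 𝕜 H Ω) (That : Triangulation Ω) (θ C κ : ℝ) : Prop :=
  ∀ T T', D.S.Refines That T → D.S.Refines T T' → D.eta T' ≤ κ * D.eta T →
    ∃ R, R ⊆ T.elems ∧ (R.card : ℝ) ≤ C * ((T.sdiff T').card : ℝ) ∧
      θ * D.eta T ^ 2 ≤ D.etaOn T R ^ 2

/-- The discrete spaces of all refinements of `That` are inf-sup stable with constant `γ`. -/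
def UniformInfSup (P : Problem 𝕜 H) (D : Discretization 𝕜 H Ω) (That : Triangulation Ω)
    (γ : ℝ) : Prop :=
  ∀ T, D.S.Refines That T → ENNReal.ofReal γ ≤ P.infSup (D.X T)

theorem UniformInfSup.solvable [CompleteSpace H] (hinf : UniformInfSup P D That γ) (hγ : 0 < γ)
    (hThat : D.Admissible That) (hT : D.S.Refines That T) : D.Solvable P T :=
  (hThat.trans hT).solvable ((ENNReal.ofReal_pos.2 hγ).trans_le (hinf T hT))

theorem UniformInfSup.exists_norm_sol_sub_le [CompleteSpace H] (hinf : UniformInfSup P D That γ)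
    (hγ : 0 < γ) (hThat : D.Admissible That) (hA4 : D.DiscreteReliability P Crel)
    (hCrel : 0 < Crel) (hT : D.Admissible T) (hs : D.Solvable P T) (hT' : D.S.Refines T T')
    (hThatT' : D.S.Refines That T') :
    ∃ R, R ⊆ T.elems ∧ T.sdiff T' ⊆ R ∧ (R.card : ℝ) ≤ Crel * ((T.sdiff T').card : ℝ) ∧
      ‖D.sol P T' - D.sol P T‖ ≤ Crel * γ⁻¹ * D.etaOn T R := by
  obtain ⟨R, hR, hA4R⟩ := hA4 T T' hT hT'
  obtain ⟨hdist, hsub, hcard⟩ := hA4R hs (hinf.solvable hγ hThat hThatT')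
  refine ⟨R, hR, hsub, hcard, hdist.trans ?_⟩
  have hinv := P.toReal_infSup_inv_le hγ (hinf T' hThatT')
  have hη : 0 ≤ D.etaOn T R := etaOn_nonneg
  gcongr

theorem exists_quasiMonotone [CompleteSpace H] (hA1 : D.Stability P Cstb)
    (hA2 : D.Reduction P Cred qred) (hA4 : D.DiscreteReliability P Crel) (hqred' : qred < 1)
    (hCrel : 0 < Crel) (hγ : 0 < γ) (hThat : D.Admissible That)
    (hinf : UniformInfSup P D That γ) : ∃ C : ℝ, 0 < C ∧ QuasiMonotone P D That C := by
  refine ⟨√(2 + (2 * Cstb ^ 2 + Cred ^ 2) * (Crel * γ⁻¹) ^ 2), by positivity,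
    fun T T' hT hs hT' hThatT' => ?_⟩
  obtain ⟨R, hR, -, -, hdist⟩ :=
    hinf.exists_norm_sol_sub_le hγ hThat hA4 hCrel hT hs hT' hThatT'
  have hdist' : ‖D.sol P T' - D.sol P T‖ ≤ Crel * γ⁻¹ * D.eta T :=
    hdist.trans (mul_le_mul_of_nonneg_left (etaOn_mono hR) (by positivity))
  have hη := hA1.eta_sq_le hA2 hT hT' hs (hinf.solvable hγ hThat hThatT') one_pos
  norm_num only at hη
  have hqred2 : qred ≤ 2 := by linarith
  refine (sq_le_sq₀ eta_nonneg (mul_nonneg (Real.sqrt_nonneg _) eta_nonneg)).1 ?_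
  calc D.eta T' ^ 2
      ≤ 2 * D.etaOn T (T.inter T') ^ 2 + 2 * D.etaOn T (T.sdiff T') ^ 2 +
        (2 * Cstb ^ 2 + Cred ^ 2) * (Crel * γ⁻¹ * D.eta T) ^ 2 := hη.trans (by gcongr)
    _ = (2 + (2 * Cstb ^ 2 + Cred ^ 2) * (Crel * γ⁻¹) ^ 2) * D.eta T ^ 2 := by
      rw [mul_pow _ (D.eta T), eta_sq_eq_inter_add_sdiff T']
      ring
    _ = _ := by rw [mul_pow (√_), Real.sq_sqrt (by positivity)]

theorem Stability.eta_sq_le_of_sdiff_subset {R : Finset (Set (EuclideanSpace ℝ (Fin d)))}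
    {c δ : ℝ} (hA1 : D.Stability P Cstb) (hT : D.Admissible T) (hT' : D.S.Refines T T')
    (hs : D.Solvable P T) (hs' : D.Solvable P T') (hR : T.sdiff T' ⊆ R)
    (hdist : ‖D.sol P T' - D.sol P T‖ ≤ c * D.etaOn T R) (hδ : 0 < δ) :
    D.eta T ^ 2 ≤ (1 + δ⁻¹) * D.eta T' ^ 2 + (1 + (1 + δ) * (Cstb * c) ^ 2) * D.etaOn T R ^ 2 := by
  have hcommon := sq_le_of_abs_sub_le (inv_pos.2 hδ)
    ((abs_sub_comm _ _).trans_le (hA1 T T' hT hT' hs hs'))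
  have hcommon' : D.etaOn T' (T'.inter T) ≤ D.eta T' :=
    etaOn_mono (by classical exact Finset.inter_subset_left)
  have hrefined : D.etaOn T (T.sdiff T') ≤ D.etaOn T R := etaOn_mono hR
  have hη : 0 ≤ D.etaOn T (T.sdiff T') := etaOn_nonneg
  have hη' : 0 ≤ D.etaOn T' (T'.inter T) := etaOn_nonneg
  rw [inv_inv, mul_pow] at hcommon
  rw [eta_sq_eq_inter_add_sdiff T', T.inter_comm]
  calc _ ≤ (1 + δ⁻¹) * D.eta T' ^ 2 + (1 + δ) * (Cstb ^ 2 * (c * D.etaOn T R) ^ 2) +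
        D.etaOn T R ^ 2 := add_le_add (hcommon.trans (by gcongr)) (by gcongr)
    _ = _ := by ring

theorem exists_doerfler_parameters {G : ℝ} (hG : 0 ≤ G) (hθ : 0 < θ) (hθG : θ * (1 + G) < 1) :
    ∃ δ κ : ℝ, 0 < δ ∧ 0 < κ ∧ ∀ x y z : ℝ, 0 ≤ y → y ≤ κ * x →
      x ^ 2 ≤ (1 + δ⁻¹) * y ^ 2 + (1 + (1 + δ) * G) * z ^ 2 → θ * x ^ 2 ≤ z ^ 2 := by
  set ζ := (1 - θ * (1 + G)) / 2 with hζ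
  have hζ0 : 0 < ζ := by linarith
  have hδG : θ * (1 + (1 + ζ / (θ * (1 + G))) * G) ≤ 1 - ζ := by
    have hle : θ * (ζ / (θ * (1 + G)) * G) ≤ ζ := by
      calc θ * (ζ / (θ * (1 + G)) * G) = ζ * (G / (1 + G)) := by field_simp
        _ ≤ ζ := mul_le_of_le_one_right hζ0.le (div_le_one_of_le₀ (by linarith) (by positivity))
    linarith
  refine ⟨ζ / (θ * (1 + G)), √(ζ / (1 + (ζ / (θ * (1 + G)))⁻¹)), by positivity, by positivity,
    fun x y z hy hyx hx => ?_⟩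
  set δ := ζ / (θ * (1 + G))
  have hδ0 : 0 < δ := by positivity
  have hsmall : (1 + δ⁻¹) * y ^ 2 ≤ ζ * x ^ 2 := by
    calc (1 + δ⁻¹) * y ^ 2 ≤ (1 + δ⁻¹) * (√(ζ / (1 + δ⁻¹)) * x) ^ 2 := by gcongr
      _ = ζ * x ^ 2 := by
        rw [mul_pow, Real.sq_sqrt (by positivity)]
        field_simp
  have hζ1 : 0 < 1 - ζ := lt_of_lt_of_le (by positivity) hδG
  refine le_of_mul_le_mul_left ?_ hζ1
  calc (1 - ζ) * (θ * x ^ 2) = θ * ((1 - ζ) * x ^ 2) := by ring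
    _ ≤ θ * ((1 + (1 + δ) * G) * z ^ 2) := mul_le_mul_of_nonneg_left (by linarith) hθ.le
    _ = θ * (1 + (1 + δ) * G) * z ^ 2 := by ring
    _ ≤ (1 - ζ) * z ^ 2 := by gcongr

theorem exists_doerflerOptimal [CompleteSpace H] (hA1 : D.Stability P Cstb)
    (hA4 : D.DiscreteReliability P Crel) (hCrel : 0 < Crel) (hγ : 0 < γ)
    (hThat : D.Admissible That) (hinf : UniformInfSup P D That γ) (hθ : 0 < θ)
    (hθ' : θ < thetaOpt Cstb Crel γ) : ∃ κ : ℝ, 0 < κ ∧ DoerflerOptimal D That θ Crel κ := by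
  have hθG : θ * (1 + (Cstb * (Crel * γ⁻¹)) ^ 2) < 1 := by
    have hG : Cstb ^ 2 * Crel ^ 2 / γ ^ 2 = (Cstb * (Crel * γ⁻¹)) ^ 2 := by field_simp
    rw [thetaOpt, hG] at hθ'
    rwa [← lt_inv_mul_iff₀' (by positivity), mul_one]
  obtain ⟨δ, κ, hδ, hκ, hpar⟩ := exists_doerfler_parameters (sq_nonneg _) hθ hθG
  refine ⟨κ, hκ, fun T T' hT hT' hη => ?_⟩
  have hThatT' : D.S.Refines That T' := Relation.ReflTransGen.trans hT hT'
  have hs := hinf.solvable hγ hThat hT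
  have hs' := hinf.solvable hγ hThat hThatT'
  obtain ⟨R, hR, hsub, hcard, hdist⟩ :=
    hinf.exists_norm_sol_sub_le hγ hThat hA4 hCrel (hThat.trans hT) hs hT' hThatT'
  exact ⟨R, hR, hcard, hpar _ _ _ eta_nonneg hη
    (hA1.eta_sq_le_of_sdiff_subset (hThat.trans hT) hT' hs hs' hsub hdist hδ)⟩

theorem exists_estimator_reduction (hA1 : D.Stability P Cstb) (hA2 : D.Reduction P Cred qred)
    (hCstb : 0 < Cstb) (hqred : 0 < qred) (hqred' : qred < 1) (hθ : 0 < θ) (hθ' : θ < 1) :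
    ∃ q C : ℝ, 0 < q ∧ q < 1 ∧ 0 < C ∧ ∀ T T' M, D.Admissible T → D.S.Refines T T' →
      D.Solvable P T → D.Solvable P T' → M ⊆ T.sdiff T' → θ * D.eta T ^ 2 ≤ D.etaOn T M ^ 2 →
      D.eta T' ^ 2 ≤ q * D.eta T ^ 2 + C * ‖D.sol P T' - D.sol P T‖ ^ 2 := by
  set t := 1 - (1 - qred) * θ with ht
  have ht0 : 0 < t := by nlinarith
  have ht1 : t < 1 := by nlinarith
  set δ := (1 - t) / (2 * t) with hδ
  have hδ0 : 0 < δ := div_pos (by linarith) (by linarith)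
  have hδt : (1 + δ) * t = (1 + t) / 2 := by
    rw [hδ]
    field_simp
    ring
  refine ⟨(1 + t) / 2, (1 + δ⁻¹) * Cstb ^ 2 + Cred ^ 2, by linarith, by linarith, by positivity,
    fun T T' M hT hT' hs hs' hM hdoerfler => (hA1.eta_sq_le hA2 hT hT' hs hs' hδ0).trans ?_⟩
  gcongr
  have hsdiff : θ * D.eta T ^ 2 ≤ D.etaOn T (T.sdiff T') ^ 2 :=
    hdoerfler.trans (pow_le_pow_left₀ etaOn_nonneg (etaOn_mono hM) 2)
  have hreduced : D.etaOn T (T.inter T') ^ 2 + qred * D.etaOn T (T.sdiff T') ^ 2 ≤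
      t * D.eta T ^ 2 := by
    rw [ht]
    linarith [eta_sq_eq_inter_add_sdiff (D := D) (T := T) T',
      mul_le_mul_of_nonneg_left hsdiff (sub_nonneg.2 hqred'.le)]
  calc _ ≤ (1 + δ) * D.etaOn T (T.inter T') ^ 2 +
        (1 + δ) * (qred * D.etaOn T (T.sdiff T') ^ 2) := by
        refine add_le_add_right (le_mul_of_one_le_left (by positivity) ?_) _
        exact le_add_of_nonneg_right hδ0.le
    _ = (1 + δ) * (D.etaOn T (T.inter T') ^ 2 + qred * D.etaOn T (T.sdiff T') ^ 2) := by ring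
    _ ≤ (1 + δ) * (t * D.eta T ^ 2) := by gcongr
    _ = (1 + t) / 2 * D.eta T ^ 2 := by rw [← mul_assoc, hδt]

end Discretization

end Estimator

section LinearConvergence

-- The reserve `μ * e ≤ μ * C₂ * h` pays for the amplification `1 + μ / 2` of `e` by means of the
-- reduction of `h`.
theorem quasi_error_contraction {q C C₂ μ e e' h h' δ : ℝ} (hC : 0 ≤ C) (hμ : 0 ≤ μ)
    (he : 0 ≤ e) (hh : 0 ≤ h) (hμC : C * (μ * C₂) = (1 - q) / 2)
    (horth : e' + δ ≤ (1 + μ / 2) * e) (hred : h' ≤ q * h + C * δ) (hrel : e ≤ C₂ * h) :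
    C * e' + h' ≤ max (1 - μ / 2) ((1 + q) / 2) * (C * e + h) := by
  calc C * e' + h' ≤ C * e' + (q * h + C * δ) := by gcongr
    _ = C * (e' + δ) + q * h := by ring
    _ ≤ C * ((1 + μ / 2) * e) + q * h := by gcongr
    _ = (1 - μ / 2) * (C * e) + C * (μ * e) + q * h := by ring
    _ ≤ (1 - μ / 2) * (C * e) + C * (μ * (C₂ * h)) + q * h := by gcongr
    _ = (1 - μ / 2) * (C * e) + (C * (μ * C₂) + q) * h := by ring
    _ = (1 - μ / 2) * (C * e) + (1 + q) / 2 * h := by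
      rw [hμC]
      ring
    _ ≤ _ := by
      rw [mul_add]
      gcongr
      · exact le_max_left _ _
      · exact le_max_right _ _

theorem exists_linear_convergence {q C C₂ : ℝ} (hq : 0 < q) (hq' : q < 1) (hC : 0 < C)
    (hC₂ : 0 < C₂) :
    ∃ ε : ℝ, 0 < ε ∧ ε < 1 ∧ ∃ Clin ρ : ℝ, 0 < Clin ∧ 0 < ρ ∧ ρ < 1 ∧
      ∀ (e h δ : ℕ → ℝ) (l₀ : ℕ), (∀ l, 0 ≤ e l) → (∀ l, 0 ≤ h l) →
        (∀ l ≥ l₀, e (l + 1) + δ l ≤ 1 / (1 - ε) * e l) →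
        (∀ l ≥ l₀, h (l + 1) ≤ q * h l + C * δ l) → (∀ l ≥ l₀, e l ≤ C₂ * h l) →
        ∀ l ≥ l₀, ∀ k, h (l + k) ≤ Clin * ρ ^ k * h l := by
  set μ := (1 - q) / (2 * C * C₂) with hμ
  have hμ0 : 0 < μ := div_pos (by linarith) (by positivity)
  have hμC : C * (μ * C₂) = (1 - q) / 2 := by
    rw [hμ]
    field_simp
  have hε : 1 / (1 - μ / 2 / (1 + μ / 2)) = 1 + μ / 2 := by
    field_simp
    ring
  set ρ := max (1 - μ / 2) ((1 + q) / 2)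
  have hρ0 : 0 < ρ := lt_max_of_lt_right (by linarith)
  refine ⟨μ / 2 / (1 + μ / 2), by positivity, (div_lt_one (by positivity)).2 (by linarith),
    C * C₂ + 1, ρ, by positivity, hρ0, max_lt (by linarith) (by linarith),
    fun e h δ l₀ he hh horth hred hrel l hl k => ?_⟩
  rw [hε] at horth
  have hcontr : C * e (l + k) + h (l + k) ≤ ρ ^ k * (C * e l + h l) :=
    le_geom (u := fun k => C * e (l + k) + h (l + k)) hρ0.le k fun j _ =>
      quasi_error_contraction hC.le hμ0.le (he _) (hh _) hμC (horth _ (Nat.le_add_right_of_le hl))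
        (hred _ (Nat.le_add_right_of_le hl)) (hrel _ (Nat.le_add_right_of_le hl))
  calc h (l + k) ≤ C * e (l + k) + h (l + k) := le_add_of_nonneg_left (mul_nonneg hC.le (he _))
    _ ≤ ρ ^ k * (C * e l + h l) := hcontr
    _ ≤ ρ ^ k * (C * (C₂ * h l) + h l) := by
      gcongr
      exact hrel l hl
    _ = (C * C₂ + 1) * ρ ^ k * h l := by ring

end LinearConvergence

section ThetaOpt

variable {Cstb Crel γ θ : ℝ}

theorem thetaOpt_le_one : thetaOpt Cstb Crel γ ≤ 1 :=
  inv_le_one_of_one_le₀ (le_add_of_nonneg_right (by positivity))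

theorem exists_lt_thetaOpt (hγ : 0 < γ) (hθ : θ < thetaOpt Cstb Crel γ) :
    ∃ γ' : ℝ, 0 < γ' ∧ γ' < γ ∧ θ < thetaOpt Cstb Crel γ' := by
  have hcont : ContinuousAt (thetaOpt Cstb Crel) γ := by
    have hsq : γ ^ 2 ≠ 0 := by positivity
    have hden : 1 + Cstb ^ 2 * Crel ^ 2 / γ ^ 2 ≠ 0 := by positivity
    unfold thetaOpt
    fun_prop (disch := assumption)
  have hnear : ∀ᶠ γ' in 𝓝[<] γ, θ < thetaOpt Cstb Crel γ' ∧ 0 < γ' :=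
    ((hcont.eventually_const_lt hθ).and (eventually_gt_nhds hγ)).filter_mono nhdsWithin_le_nhds
  obtain ⟨γ', ⟨hθγ', hγ'⟩, hlt⟩ := (hnear.and self_mem_nhdsWithin).exists
  exact ⟨γ', hγ', hlt, hθγ'⟩

end ThetaOpt

section RealPowers

theorem one_le_rpow_mul_rpow_neg {x M t : ℝ} (hx : 0 < x) (hxM : x ≤ M) (ht : 0 ≤ t) :
    1 ≤ M ^ t * x ^ (-t) := by
  rw [Real.rpow_neg hx.le, ← div_eq_mul_inv, ← Real.div_rpow (hx.le.trans hxM) hx.le]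
  exact Real.one_le_rpow ((one_le_div hx).2 hxM) ht

theorem le_rpow_mul_rpow_neg {x c C s : ℝ} (hs : 0 < s) (hx : 0 < x) (hc : 0 < c) (hC : 0 ≤ C)
    (h : c ≤ C * x ^ (-s⁻¹)) : x ≤ C ^ s * c ^ (-s) := by
  have hpow : c ^ s ≤ C ^ s * x⁻¹ := by
    calc c ^ s ≤ (C * x ^ (-s⁻¹)) ^ s := by gcongr
      _ = C ^ s * x⁻¹ := by
        rw [Real.mul_rpow hC (by positivity), ← Real.rpow_mul hx.le, neg_mul,
          inv_mul_cancel₀ hs.ne', Real.rpow_neg_one]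
  rw [← div_eq_mul_inv, le_div_iff₀ hx] at hpow
  rw [Real.rpow_neg hc.le, ← div_eq_mul_inv, le_div_iff₀ (by positivity)]
  linarith

theorem rpow_neg_le_of_le_mul {x y c t : ℝ} (hx : 0 < x) (hc : 0 < c) (ht : 0 ≤ t)
    (h : x ≤ c * y) : y ^ (-t) ≤ c ^ t * x ^ (-t) := by
  have hy : 0 < y := pos_of_mul_pos_right (hx.trans_le h) hc.le
  rw [Real.rpow_neg hx.le, Real.rpow_neg hy.le, ← div_eq_mul_inv, le_div_iff₀ (by positivity),
    inv_mul_le_iff₀ (by positivity), mul_comm, ← Real.mul_rpow hc.le hy.le]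
  gcongr

theorem sum_Ico_pow_sub_le {σ : ℝ} (hσ : 0 ≤ σ) (hσ' : σ < 1) (k l : ℕ) :
    ∑ j ∈ Finset.Ico k l, σ ^ (l - j) ≤ (1 - σ)⁻¹ := by
  have hσ1 : 0 < 1 - σ := by linarith
  rw [Finset.sum_Ico_reflect (fun i => σ ^ i) k (Nat.le_succ l), Nat.add_sub_cancel_left]
  calc _ ≤ σ ^ 1 / (1 - σ) := geom_sum_Ico_le_of_lt_one hσ hσ'
    _ ≤ (1 - σ)⁻¹ := by
      rw [pow_one, ← one_div]
      gcongr

theorem sum_rpow_neg_le {h : ℕ → ℝ} {C ρ t : ℝ} (hC : 0 < C) (hρ : 0 < ρ) (hρ' : ρ < 1)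
    (ht : 0 < t) {k : ℕ} (hh : ∀ j ≥ k, ∀ i, h (j + i) ≤ C * ρ ^ i * h j) {l : ℕ}
    (hpos : 0 < h l) :
    ∑ j ∈ Finset.Ico k l, h j ^ (-t) ≤ C ^ t * (1 - ρ ^ t)⁻¹ * h l ^ (-t) := by
  have hterm : ∀ j ∈ Finset.Ico k l, h j ^ (-t) ≤ C ^ t * h l ^ (-t) * (ρ ^ t) ^ (l - j) := by
    intro j hj
    obtain ⟨hkj, hjl⟩ := Finset.mem_Ico.1 hj
    have hlj := hh j hkj (l - j)
    rw [Nat.add_sub_cancel' hjl.le] at hlj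
    refine (rpow_neg_le_of_le_mul hpos (by positivity) ht.le hlj).trans_eq ?_
    rw [Real.mul_rpow hC.le (by positivity), Real.rpow_pow_comm hρ.le]
    ring
  have hgeom := sum_Ico_pow_sub_le (Real.rpow_nonneg hρ.le t) (Real.rpow_lt_one hρ.le hρ' ht) k l
  calc _ ≤ C ^ t * h l ^ (-t) * ∑ j ∈ Finset.Ico k l, (ρ ^ t) ^ (l - j) := by
        rw [Finset.mul_sum]
        exact Finset.sum_le_sum hterm
    _ ≤ C ^ t * h l ^ (-t) * (1 - ρ ^ t)⁻¹ := by gcongr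
    _ = _ := by ring

end RealPowers

section Rates

variable {d : ℕ} {Ω : Set (EuclideanSpace ℝ (Fin d))}
  {𝕜 : Type*} [RCLike 𝕜] {H : Type*} [NormedAddCommGroup H] [InnerProductSpace 𝕜 H]
  {P : Problem 𝕜 H} {D : Discretization 𝕜 H Ω}
  {Cstb Cred qred Crel' Crel Cmesh Cmark γ θ s C : ℝ} {T That : Triangulation Ω}

namespace Discretization

/-- The least estimator value among all meshes with at most `N` additional elements, so that
`approxNorm` is the supremum of `(N + 1)^s * minEta P D N`. -/
def minEta (P : Problem 𝕜 H) (D : Discretization 𝕜 H Ω) (N : ℕ) : ℝ :=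
  sInf (D.eta '' D.meshesUpTo P D.T0 N)

theorem minEta_le {N : ℕ} (hT : T ∈ D.meshesUpTo P D.T0 N) : minEta P D N ≤ D.eta T :=
  csInf_le ⟨0, by rintro _ ⟨T', -, rfl⟩; exact eta_nonneg⟩ ⟨T, hT, rfl⟩

theorem approxNorm_lt_top_iff :
    D.approxNorm P s < ⊤ ↔ BddAbove (Set.range fun N : ℕ => ((N : ℝ) + 1) ^ s * minEta P D N) := by
  constructor
  · intro hfin
    refine ⟨(D.approxNorm P s).toReal, ?_⟩
    rintro _ ⟨N, rfl⟩
    exact (ENNReal.ofReal_le_iff_le_toReal hfin.ne).1 (le_iSup (fun N : ℕ =>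
      ENNReal.ofReal (((N : ℝ) + 1) ^ s * minEta P D N)) N)
  · rintro ⟨A, hA⟩
    exact (iSup_le fun N => ENNReal.ofReal_le_ofReal (hA ⟨N, rfl⟩)).trans_lt ENNReal.ofReal_lt_top

-- Meshes with fewer than `#That` elements are avoided, since the minimum over the empty set is `0`.
theorem exists_mesh_eta_le (hThat : D.Admissible That) (hsol : D.Solvable P That) (hs : 0 < s)
    (hfin : D.approxNorm P s < ⊤) :
    ∃ B : ℝ, 0 < B ∧ ∀ ε : ℝ, 0 < ε → ∃ (N : ℕ) (T : Triangulation Ω),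
      T ∈ D.meshesUpTo P D.T0 N ∧ D.eta T ≤ ε ∧ (N : ℝ) ≤ That.card + B * ε ^ (-s⁻¹) := by
  obtain ⟨A, hA⟩ := approxNorm_lt_top_iff.1 hfin
  have hA0 : 0 < max A 1 := lt_max_of_lt_right one_pos
  refine ⟨max A 1 ^ s⁻¹, by positivity, fun ε hε => ?_⟩
  set x := (max A 1 / ε) ^ s⁻¹ with hx
  have hxε : x = max A 1 ^ s⁻¹ * ε ^ (-s⁻¹) := by
    rw [hx, Real.div_rpow hA0.le hε.le, Real.rpow_neg hε.le, div_eq_mul_inv]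
  set N := That.card + ⌊x⌋₊ with hN
  have hxN : x < (N : ℝ) + 1 := by
    rw [hN, Nat.cast_add]
    linarith [Nat.lt_floor_add_one x, (Nat.cast_nonneg That.card : (0 : ℝ) ≤ _)]
  have hpow : max A 1 / ε < ((N : ℝ) + 1) ^ s := by
    calc max A 1 / ε = x ^ s := (Real.rpow_inv_rpow (by positivity) hs.ne').symm
      _ < ((N : ℝ) + 1) ^ s := by gcongr
  have hmin : minEta P D N < ε := by
    have hprod : ((N : ℝ) + 1) ^ s * minEta P D N < ((N : ℝ) + 1) ^ s * ε :=
      ((hA ⟨N, rfl⟩).trans (le_max_left A 1)).trans_lt ((div_lt_iff₀ hε).1 hpow)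
    exact lt_of_mul_lt_mul_left hprod (by positivity)
  have hne : (D.eta '' D.meshesUpTo P D.T0 N).Nonempty :=
    ⟨_, That, ⟨hThat, by omega, hsol⟩, rfl⟩
  obtain ⟨_, ⟨T, hT, rfl⟩, hTε⟩ := exists_lt_of_csInf_lt hne hmin
  refine ⟨N, T, hT, hTε.le, ?_⟩
  rw [hN, Nat.cast_add, ← hxε]
  linarith [Nat.floor_le (by positivity : 0 ≤ x)]

theorem exists_card_sdiff_le {Cmon κ : ℝ} (hoverlay : D.Overlay) (hThat : D.Admissible That)
    (hsol : D.Solvable P That) (hCmon : 0 < Cmon) (hmon : QuasiMonotone P D That Cmon)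
    (hκ : 0 < κ) (hs : 0 < s) (hfin : D.approxNorm P s < ⊤) :
    ∃ C : ℝ, 0 < C ∧ ∀ T, D.S.Refines That T → 0 < D.eta T → ∃ T', D.S.Refines T T' ∧
      D.eta T' ≤ κ * D.eta T ∧ ((T.sdiff T').card : ℝ) ≤ C * D.eta T ^ (-s⁻¹) := by
  obtain ⟨B, hB, happrox⟩ := exists_mesh_eta_le hThat hsol hs hfin
  have hM : 0 ≤ Cmon * D.eta That := mul_nonneg hCmon.le eta_nonneg
  refine ⟨That.card * (Cmon * D.eta That) ^ s⁻¹ + B * (κ / Cmon) ^ (-s⁻¹), by positivity,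
    fun T hT hη => ?_⟩
  have hTadm := hThat.trans hT
  obtain ⟨N, Tε, ⟨hTε, hTεcard, hTεsol⟩, hTεη, hN⟩ :=
    happrox (κ / Cmon * D.eta T) (by positivity)
  obtain ⟨T', hT', hTεT', hcard⟩ := hoverlay D.T0 T Tε Relation.ReflTransGen.refl hTadm hTε
  refine ⟨T', hT', ?_, ?_⟩
  · calc D.eta T' ≤ Cmon * D.eta Tε :=
          hmon Tε T' hTε hTεsol hTεT' (Relation.ReflTransGen.trans hT hT')
      _ ≤ Cmon * (κ / Cmon * D.eta T) := by gcongr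
      _ = κ * D.eta T := by field_simp
  · have hsdiff : (T.sdiff T').card ≤ N := by
      have := hTadm.card_add_card_sdiff_le hT'
      omega
    have hone : 1 ≤ (Cmon * D.eta That) ^ s⁻¹ * D.eta T ^ (-s⁻¹) :=
      one_le_rpow_mul_rpow_neg hη (hmon That T hThat hsol hT hT) (by positivity)
    calc ((T.sdiff T').card : ℝ) ≤ N := by exact_mod_cast hsdiff
      _ ≤ That.card * 1 + B * (κ / Cmon * D.eta T) ^ (-s⁻¹) := by rwa [mul_one]
      _ ≤ That.card * ((Cmon * D.eta That) ^ s⁻¹ * D.eta T ^ (-s⁻¹)) +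
          B * ((κ / Cmon) ^ (-s⁻¹) * D.eta T ^ (-s⁻¹)) := by
        rw [Real.mul_rpow (by positivity) hη.le]
        gcongr
      _ = _ := by ring

end Discretization

namespace AdaptiveRun

/-- R-linear convergence of the estimator from the index `k` on. -/
def LinearConvergenceFrom (r : AdaptiveRun P D θ Cmark) (C ρ : ℝ) (k : ℕ) : Prop :=
  ∀ l ≥ k, ∀ i, D.eta (r.mesh (l + i)) ≤ C * ρ ^ i * D.eta (r.mesh l)

variable (r : AdaptiveRun P D θ Cmark)

theorem QuasiOrthogonalFrom.mono {r : AdaptiveRun P D θ Cmark} {ε : ℝ} {k l : ℕ}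
    (h : r.QuasiOrthogonalFrom ε k) (hkl : k ≤ l) : r.QuasiOrthogonalFrom ε l :=
  fun j hj => h j (hkl.trans hj)

theorem card_T0_le (l : ℕ) : D.T0.card ≤ (r.mesh l).card :=
  Discretization.Admissible.card_le Relation.ReflTransGen.refl (r.admissible l)

theorem RateFrom.mono {r : AdaptiveRun P D θ Cmark} {C' : ℝ} {k : ℕ} (h : r.RateFrom s C k)
    (hC : C ≤ C') : r.RateFrom s C' k := fun l hl => by
  have hcard : (D.T0.card : ℝ) ≤ (r.mesh l).card := by exact_mod_cast r.card_T0_le l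
  have hpow : (0 : ℝ) ≤ ((r.mesh l).card - D.T0.card + 1 : ℝ) ^ (-s) :=
    Real.rpow_nonneg (by linarith) _
  exact (h l hl).trans (mul_le_mul_of_nonneg_right hC hpow)

theorem exists_linearConvergenceFrom (hA1 : D.Stability P Cstb) (hA2 : D.Reduction P Cred qred)
    (hA3 : D.Reliability P Crel') (hCstb : 0 < Cstb) (hqred : 0 < qred) (hqred' : qred < 1)
    (hθ : 0 < θ) (hθ' : θ < 1) :
    ∃ ε : ℝ, 0 < ε ∧ ε < 1 ∧ ∃ C ρ : ℝ, 0 < C ∧ 0 < ρ ∧ ρ < 1 ∧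
      ∀ (r : AdaptiveRun P D θ Cmark) (k : ℕ), r.QuasiOrthogonalFrom ε k →
        (∀ l ≥ k, D.Solvable P (r.mesh l)) → r.LinearConvergenceFrom C ρ k := by
  obtain ⟨α, hα, hell⟩ := P.elliptic
  obtain ⟨q, Cq, hq, hq', hCq, hred⟩ :=
    Discretization.exists_estimator_reduction hA1 hA2 hCstb hqred hqred' hθ hθ'
  obtain ⟨ε, hε, hε', C, ρ, hC, hρ, hρ', hlin⟩ :=
    exists_linear_convergence (C := Cq / α) (C₂ := ‖P.a‖ * Crel' ^ 2 + 1) hq hq'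
      (by positivity) (by positivity)
  refine ⟨ε, hε, hε', √C, √ρ, by positivity, by positivity, (Real.sqrt_lt' one_pos).2 (by simpa),
    fun r k horth hsol l hl i => ?_⟩
  have hreduction : ∀ l ≥ k, D.eta (r.mesh (l + 1)) ^ 2 ≤
      q * D.eta (r.mesh l) ^ 2 + Cq / α * P.energySq (r.U (l + 1) - r.U l) := fun l hl => by
    have hs := hsol l hl
    have hs' := hsol (l + 1) (Nat.le_succ_of_le hl)
    have hstep := hred _ _ _ (r.admissible l) (r.refines_succ l) hs hs' (r.marked_subset_sdiff l)
      (r.doerfler l hs)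
    rw [← r.U_of_solvable hs, ← r.U_of_solvable hs'] at hstep
    refine hstep.trans (add_le_add_right ?_ _)
    rw [div_mul_eq_mul_div, le_div_iff₀ hα, mul_assoc, mul_comm _ α]
    exact mul_le_mul_of_nonneg_left (hell _) hCq.le
  have hreliability : ∀ l ≥ k, P.energySq (P.u - r.U l) ≤
      (‖P.a‖ * Crel' ^ 2 + 1) * D.eta (r.mesh l) ^ 2 := fun l hl => by
    have hrel := hA3 _ (r.admissible l) (hsol l hl)
    rw [← r.U_of_solvable (hsol l hl)] at hrel
    calc P.energySq (P.u - r.U l) ≤ ‖P.a‖ * ‖P.u - r.U l‖ ^ 2 := P.energySq_le _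
      _ ≤ ‖P.a‖ * (Crel' * D.eta (r.mesh l)) ^ 2 := by gcongr
      _ ≤ _ := by linarith [sq_nonneg (D.eta (r.mesh l))]
  have hsq := hlin (fun l => P.energySq (P.u - r.U l)) (fun l => D.eta (r.mesh l) ^ 2)
    (fun l => P.energySq (r.U (l + 1) - r.U l)) k (fun _ => P.energySq_nonneg _)
    (fun _ => sq_nonneg _) horth hreduction hreliability l hl i
  calc D.eta (r.mesh (l + i)) ≤ √(C * ρ ^ i * D.eta (r.mesh l) ^ 2) := Real.le_sqrt_of_sq_le hsq
    _ = √C * √ρ ^ i * D.eta (r.mesh l) := by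
      rw [Real.sqrt_mul (by positivity), Real.sqrt_mul hC.le,
        Real.sqrt_sq Discretization.eta_nonneg, Real.sqrt_eq_rpow (ρ ^ i),
        ← Real.rpow_pow_comm hρ.le, ← Real.sqrt_eq_rpow]

theorem exists_card_marked_le {Cmon κ : ℝ} (hoverlay : D.Overlay) (hThat : D.Admissible That)
    (hsol : ∀ T, D.S.Refines That T → D.Solvable P T) (hCmon : 0 < Cmon)
    (hmon : Discretization.QuasiMonotone P D That Cmon) (hκ : 0 < κ)
    (hopt : Discretization.DoerflerOptimal D That θ Crel κ) (hCrel : 0 < Crel)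
    (hCmark : 0 < Cmark) (hs : 0 < s) (hfin : D.approxNorm P s < ⊤) :
    ∃ C : ℝ, 0 < C ∧ ∀ (r : AdaptiveRun P D θ Cmark) (l : ℕ), D.S.Refines That (r.mesh l) →
      0 < D.eta (r.mesh l) → ((r.marked l).card : ℝ) ≤ C * D.eta (r.mesh l) ^ (-s⁻¹) := by
  obtain ⟨C, hC, hsdiff⟩ := Discretization.exists_card_sdiff_le hoverlay hThat
    (hsol That Relation.ReflTransGen.refl) hCmon hmon hκ hs hfin
  refine ⟨Cmark * (Crel * C), by positivity, fun r l href hη => ?_⟩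
  obtain ⟨T', hT', hT'η, hcard⟩ := hsdiff _ href hη
  obtain ⟨R, hR, hRcard, hRη⟩ := hopt _ T' href hT' hT'η
  calc ((r.marked l).card : ℝ) ≤ Cmark * R.card := r.marked_minimal l (hsol _ href) R hR hRη
    _ ≤ Cmark * (Crel * (C * D.eta (r.mesh l) ^ (-s⁻¹))) := by
      gcongr
      exact hRcard.trans (by gcongr)
    _ = _ := by ring

theorem card_sub_card_T0_add_one_le {C₁ ρ M t : ℝ} {k l : ℕ} (hmesh : r.MeshClosure Cmesh)
    (hCmesh : 0 ≤ Cmesh) (hlin : r.LinearConvergenceFrom C ρ k) (hC : 0 < C) (hρ : 0 < ρ)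
    (hρ' : ρ < 1) (hC₁ : 0 ≤ C₁) (ht : 0 < t)
    (hmark : ∀ j ≥ k, 0 < D.eta (r.mesh j) →
      ((r.marked j).card : ℝ) ≤ C₁ * D.eta (r.mesh j) ^ (-t))
    (hkl : k ≤ l) (hη : 0 < D.eta (r.mesh l)) (hM : D.eta (r.mesh l) ≤ M) :
    ((r.mesh l).card : ℝ) - D.T0.card + 1 ≤
      ((Cmesh * (r.mesh k).card + 1) * M ^ t + Cmesh * (C₁ * (C ^ t * (1 - ρ ^ t)⁻¹))) *
        D.eta (r.mesh l) ^ (-t) := by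
  have hpos : ∀ j ∈ Finset.Ico k l, 0 < D.eta (r.mesh j) := fun j hj => by
    obtain ⟨hkj, hjl⟩ := Finset.mem_Ico.1 hj
    have hlj := hlin j hkj (l - j)
    rw [Nat.add_sub_cancel' hjl.le] at hlj
    exact pos_of_mul_pos_right (hη.trans_le hlj) (by positivity)
  have hone : 1 ≤ M ^ t * D.eta (r.mesh l) ^ (-t) := one_le_rpow_mul_rpow_neg hη hM ht.le
  have hbefore : ∑ j ∈ Finset.range k, ((r.marked j).card : ℝ) ≤ (r.mesh k).card := by
    exact_mod_cast (Nat.le_add_left _ _).trans (r.sum_card_marked_le k)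
  have hafter : ∑ j ∈ Finset.Ico k l, ((r.marked j).card : ℝ) ≤
      C₁ * (C ^ t * (1 - ρ ^ t)⁻¹ * D.eta (r.mesh l) ^ (-t)) := by
    calc _ ≤ ∑ j ∈ Finset.Ico k l, C₁ * D.eta (r.mesh j) ^ (-t) :=
          Finset.sum_le_sum fun j hj => hmark j (Finset.mem_Ico.1 hj).1 (hpos j hj)
      _ ≤ _ := by
        rw [← Finset.mul_sum]
        exact mul_le_mul_of_nonneg_left (sum_rpow_neg_le
          (h := fun j => D.eta (r.mesh j)) hC hρ hρ' ht hlin hη) hC₁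
  calc ((r.mesh l).card : ℝ) - D.T0.card + 1
      ≤ Cmesh * (∑ j ∈ Finset.range k, ((r.marked j).card : ℝ) +
        ∑ j ∈ Finset.Ico k l, ((r.marked j).card : ℝ)) + 1 := by
        rw [Finset.sum_range_add_sum_Ico _ hkl]
        exact add_le_add_left (hmesh l) 1
    _ ≤ Cmesh * ((r.mesh k).card + C₁ * (C ^ t * (1 - ρ ^ t)⁻¹ * D.eta (r.mesh l) ^ (-t))) + 1 := by
        gcongr
    _ = (Cmesh * (r.mesh k).card + 1) * 1 +
        Cmesh * (C₁ * (C ^ t * (1 - ρ ^ t)⁻¹)) * D.eta (r.mesh l) ^ (-t) := by ring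
    _ ≤ (Cmesh * (r.mesh k).card + 1) * (M ^ t * D.eta (r.mesh l) ^ (-t)) +
        Cmesh * (C₁ * (C ^ t * (1 - ρ ^ t)⁻¹)) * D.eta (r.mesh l) ^ (-t) := by gcongr
    _ = _ := by ring

theorem rateFrom_of_card_le {k : ℕ} (hsol : ∀ l ≥ k, D.Solvable P (r.mesh l)) (hs : 0 < s)
    (hC : 0 ≤ C) (hcard : ∀ l ≥ k, 0 < D.eta (r.mesh l) →
      ((r.mesh l).card : ℝ) - D.T0.card + 1 ≤ C * D.eta (r.mesh l) ^ (-s⁻¹)) :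
    r.RateFrom s (C ^ s) k := by
  intro l hl
  have hT0 : (D.T0.card : ℝ) ≤ (r.mesh l).card := by exact_mod_cast r.card_T0_le l
  have hpos : 0 < ((r.mesh l).card : ℝ) - D.T0.card + 1 := by linarith
  rw [r.est_of_solvable (hsol l hl)]
  obtain hη | hη := (Discretization.eta_nonneg (D := D) (T := r.mesh l)).eq_or_lt
  · rw [← hη]
    positivity
  · exact le_rpow_mul_rpow_neg hs hη hpos hC (hcard l hl hη)

theorem exists_rateFrom [CompleteSpace H] (hA1 : D.Stability P Cstb)
    (hA2 : D.Reduction P Cred qred) (hA4 : D.DiscreteReliability P Crel) (hoverlay : D.Overlay)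
    (hqred' : qred < 1) (hCrel : 0 < Crel) (hCmesh : 0 ≤ Cmesh) (hCmark : 0 < Cmark) (hγ : 0 < γ)
    (hThat : D.Admissible That) (hinf : Discretization.UniformInfSup P D That γ) (hθ : 0 < θ)
    (hθ' : θ < thetaOpt Cstb Crel γ) {Clin ρ : ℝ} (hClin : 0 < Clin) (hρ : 0 < ρ) (hρ' : ρ < 1)
    (hs : 0 < s) (hfin : D.approxNorm P s < ⊤) (n : ℕ) :
    ∃ C : ℝ, 0 ≤ C ∧ ∀ (r : AdaptiveRun P D θ Cmark) (k : ℕ), r.MeshClosure Cmesh →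
      r.LinearConvergenceFrom Clin ρ k → (∀ l ≥ k, D.S.Refines That (r.mesh l)) →
      (r.mesh k).card = n → r.RateFrom s C k := by
  obtain ⟨Cmon, hCmon, hmon⟩ :=
    Discretization.exists_quasiMonotone hA1 hA2 hA4 hqred' hCrel hγ hThat hinf
  obtain ⟨κ, hκ, hopt⟩ :=
    Discretization.exists_doerflerOptimal hA1 hA4 hCrel hγ hThat hinf hθ hθ'
  have hsol : ∀ T, D.S.Refines That T → D.Solvable P T := fun T hT => hinf.solvable hγ hThat hT
  obtain ⟨C₁, hC₁, hmark⟩ :=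
    exists_card_marked_le hoverlay hThat hsol hCmon hmon hκ hopt hCrel hCmark hs hfin
  have hM : 0 ≤ Cmon * D.eta That := mul_nonneg hCmon.le Discretization.eta_nonneg
  have hρs : 0 ≤ (1 - ρ ^ s⁻¹)⁻¹ :=
    inv_nonneg.2 (sub_nonneg.2 (Real.rpow_le_one hρ.le hρ'.le (by positivity)))
  refine ⟨((Cmesh * n + 1) * (Cmon * D.eta That) ^ s⁻¹ +
    Cmesh * (C₁ * (Clin ^ s⁻¹ * (1 - ρ ^ s⁻¹)⁻¹))) ^ s, by positivity, ?_⟩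
  rintro r k hmesh hlin href rfl
  refine r.rateFrom_of_card_le (fun l hl => hsol _ (href l hl)) hs (by positivity)
    fun l hl hη => ?_
  exact r.card_sub_card_T0_add_one_le hmesh hCmesh hlin hClin hρ hρ' hC₁.le (inv_pos.2 hs)
    (fun j hj => hmark r j (href j hj)) hl hη
    (hmon That _ hThat (hsol That Relation.ReflTransGen.refl) (href l hl) (href l hl))

variable {r}

theorem eta_eq_zero_of_marked_eq_empty (hθ : 0 < θ) {l : ℕ} (hsol : D.Solvable P (r.mesh l))
    (hM : r.marked l = ∅) : D.eta (r.mesh l) = 0 := by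
  have hdoerfler := r.doerfler l hsol
  rw [hM, Discretization.etaOn_sq, Finset.sum_empty] at hdoerfler
  exact sq_eq_zero_iff.1 (le_antisymm (nonpos_of_mul_nonpos_right hdoerfler hθ) (sq_nonneg _))

theorem exists_marked_eq_empty_of_card_le {B k : ℕ} (hcard : ∀ l ≥ k, (r.mesh l).card ≤ B) :
    ∃ l ≥ k, r.marked l = ∅ := by
  by_contra! hne
  have hmono : StrictMono fun i => (r.mesh (k + i)).card := strictMono_nat_of_lt_succ fun i =>
    (Nat.lt_add_of_pos_right (hne _ (Nat.le_add_right k i)).card_pos).trans_le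
      (r.card_add_card_marked_le (k + i))
  exact (hmono.le_apply (x := B + 1)).not_gt
    (Nat.lt_succ_of_le (hcard _ (Nat.le_add_right k (B + 1))))

theorem exists_eta_eq_zero_or_lt_card_succ (hθ : 0 < θ) {B k : ℕ}
    (hsol : ∀ l ≥ k, D.Solvable P (r.mesh l)) (hk : (r.mesh k).card ≤ B) :
    ∃ l ≥ k, (r.mesh l).card ≤ B ∧ (D.eta (r.mesh l) = 0 ∨ B < (r.mesh (l + 1)).card) := by
  by_cases hcross : ∃ l ≥ k, (r.mesh l).card ≤ B ∧ B < (r.mesh (l + 1)).card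
  · obtain ⟨l, hl, hle, hlt⟩ := hcross
    exact ⟨l, hl, hle, Or.inr hlt⟩
  · push Not at hcross
    have hcard : ∀ l ≥ k, (r.mesh l).card ≤ B := fun l hl => by
      induction l, hl using Nat.le_induction with
      | base => exact hk
      | succ l hl ih => exact hcross l hl ih
    obtain ⟨l, hl, hM⟩ := exists_marked_eq_empty_of_card_le hcard
    exact ⟨l, hl, hcard l hl, Or.inl (eta_eq_zero_of_marked_eq_empty hθ (hsol l hl) hM)⟩

theorem add_one_le_mul_card_sub_card_T0_add_one {Cson N l : ℕ} (hsons : D.SonBounds Cson)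
    (hN : D.T0.card + N < (r.mesh (l + 1)).card) :
    (N : ℝ) + 1 ≤ (Cson + 1) * (D.T0.card + 1) * ((r.mesh l).card - D.T0.card + 1) := by
  have hT0 : (D.T0.card : ℝ) ≤ (r.mesh l).card := by exact_mod_cast r.card_T0_le l
  have hsucc : N + 1 ≤ (Cson + 1) * (r.mesh l).card := by
    have := hsons.card_refine_le (r.admissible l) (r.marked_subset l)
    rw [← r.mesh_succ] at this
    omega
  have hcard : ((r.mesh l).card : ℝ) ≤ (D.T0.card + 1) * ((r.mesh l).card - D.T0.card + 1) := by
    nlinarith [(Nat.cast_nonneg D.T0.card : (0 : ℝ) ≤ _)]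
  calc (N : ℝ) + 1 ≤ (Cson + 1) * (r.mesh l).card := by exact_mod_cast hsucc
    _ ≤ _ := by
      rw [mul_assoc]
      gcongr

theorem rpow_mul_minEta_le {Cson N k : ℕ} (hsons : D.SonBounds Cson) (hθ : 0 < θ)
    (hsol : ∀ l ≥ k, D.Solvable P (r.mesh l)) (hs : 0 < s) (hrate : r.RateFrom s C k)
    (hN : (r.mesh k).card ≤ D.T0.card + N) :
    ((N : ℝ) + 1) ^ s * Discretization.minEta P D N ≤
      ((Cson + 1) * (D.T0.card + 1) : ℝ) ^ s * |C| := by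
  obtain ⟨l, hl, hcard, hlarge⟩ := exists_eta_eq_zero_or_lt_card_succ hθ hsol hN
  have hmin : Discretization.minEta P D N ≤ D.eta (r.mesh l) :=
    Discretization.minEta_le ⟨r.admissible l, hcard, hsol l hl⟩
  obtain hη | hlt := hlarge
  · rw [hη] at hmin
    exact (mul_nonpos_of_nonneg_of_nonpos (by positivity) hmin).trans (by positivity)
  have hT0 : (D.T0.card : ℝ) ≤ (r.mesh l).card := by exact_mod_cast r.card_T0_le l
  have hpos : 0 < ((r.mesh l).card : ℝ) - D.T0.card + 1 := by linarith
  have hη := hrate l hl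
  rw [r.est_of_solvable (hsol l hl), Real.rpow_neg hpos.le, ← div_eq_mul_inv,
    le_div_iff₀' (by positivity)] at hη
  have hη0 : 0 ≤ D.eta (r.mesh l) := Discretization.eta_nonneg
  calc ((N : ℝ) + 1) ^ s * Discretization.minEta P D N
      ≤ ((N : ℝ) + 1) ^ s * D.eta (r.mesh l) := by gcongr
    _ ≤ ((Cson + 1) * (D.T0.card + 1) * ((r.mesh l).card - D.T0.card + 1) : ℝ) ^ s *
        D.eta (r.mesh l) := by
      gcongr
      exact add_one_le_mul_card_sub_card_T0_add_one hsons hlt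
    _ = ((Cson + 1) * (D.T0.card + 1) : ℝ) ^ s *
        (((r.mesh l).card - D.T0.card + 1 : ℝ) ^ s * D.eta (r.mesh l)) := by
      rw [Real.mul_rpow (by positivity) hpos.le, mul_assoc]
    _ ≤ _ := by
      gcongr
      exact hη.trans (le_abs_self C)

theorem approxNorm_lt_top {Cson k : ℕ} (hsons : D.SonBounds Cson) (hθ : 0 < θ)
    (hsol : ∀ l ≥ k, D.Solvable P (r.mesh l)) (hs : 0 < s) (hrate : r.RateFrom s C k) :
    D.approxNorm P s < ⊤ := by
  refine Discretization.approxNorm_lt_top_iff.2 (IsBoundedUnder.bddAbove_range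
    ⟨((Cson + 1) * (D.T0.card + 1) : ℝ) ^ s * |C|, eventually_map.2 ?_⟩)
  filter_upwards [eventually_ge_atTop (r.mesh k).card] with N hN
  exact rpow_mul_minEta_le hsons hθ hsol hs hrate (hN.trans (Nat.le_add_left _ _))

end AdaptiveRun

theorem exists_optimal_rates [CompleteSpace H] {Cson : ℕ} (hA1 : D.Stability P Cstb)
    (hA2 : D.Reduction P Cred qred) (hA3 : D.Reliability P Crel')
    (hA4 : D.DiscreteReliability P Crel) (hsons : D.SonBounds Cson) (hoverlay : D.Overlay)
    (hCstb : 0 < Cstb) (hqred : 0 < qred) (hqred' : qred < 1) (hCrel : 0 < Crel)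
    (hCmesh : 0 ≤ Cmesh) (hCmark : 0 < Cmark) (hγ : 0 < γ) (hThat : D.Admissible That)
    (hinf : Discretization.UniformInfSup P D That γ) (hθ : 0 < θ)
    (hθ' : θ < thetaOpt Cstb Crel γ) :
    ∃ ε : ℝ, 0 < ε ∧ ε < 1 ∧ ∀ s : ℝ, 0 < s → ∀ n : ℕ, ∃ Copt : ℝ, 0 < Copt ∧ ∀ C ≥ Copt,
      ∀ r : AdaptiveRun P D θ Cmark, r.MeshClosure Cmesh → ∀ k : ℕ, r.QuasiOrthogonalFrom ε k →
        (∀ l ≥ k, D.S.Refines That (r.mesh l)) → (r.mesh k).card = n →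
        (D.approxNorm P s < ⊤ ↔ r.RateFrom s C k) := by
  obtain ⟨ε, hε, hε', Clin, ρ, hClin, hρ, hρ', hlin⟩ :=
    AdaptiveRun.exists_linearConvergenceFrom (Cmark := Cmark) hA1 hA2 hA3 hCstb hqred hqred' hθ
      (hθ'.trans_le thetaOpt_le_one)
  have hsol : ∀ T, D.S.Refines That T → D.Solvable P T := fun T hT => hinf.solvable hγ hThat hT
  refine ⟨ε, hε, hε', fun s hs n => ?_⟩
  by_cases hfin : D.approxNorm P s < ⊤
  · obtain ⟨C₀, hC₀, hrate⟩ := AdaptiveRun.exists_rateFrom hA1 hA2 hA4 hoverlay hqred' hCrel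
      hCmesh hCmark hγ hThat hinf hθ hθ' hClin hρ hρ' hs hfin n
    refine ⟨C₀ + 1, by positivity, fun C hC r hmesh k horth href hn =>
      iff_of_true hfin <|
        AdaptiveRun.RateFrom.mono ?_ ((le_add_of_nonneg_right zero_le_one).trans hC)⟩
    exact hrate r k hmesh (hlin r k horth fun l hl => hsol _ (href l hl)) href hn
  · exact ⟨1, one_pos, fun C _ r _ k _ href _ => iff_of_false hfin fun hrate => hfin <|
      AdaptiveRun.approxNorm_lt_top hsons hθ (fun l hl => hsol _ (href l hl)) hs hrate⟩

theorem AdaptiveRun.exists_optimal_rates [CompleteSpace H] {Cson : ℕ} {F : Submodule 𝕜 H}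
    [FiniteDimensional 𝕜 F] (r : AdaptiveRun P D θ Cmark) (hA1 : D.Stability P Cstb)
    (hA2 : D.Reduction P Cred qred) (hA3 : D.Reliability P Crel')
    (hA4 : D.DiscreteReliability P Crel) (hsons : D.SonBounds Cson) (hoverlay : D.Overlay)
    (hCstb : 0 < Cstb) (hqred : 0 < qred) (hqred' : qred < 1) (hCrel : 0 < Crel)
    (hCmesh : 0 ≤ Cmesh) (hCmark : 0 < Cmark) (hγ : 0 < γ)
    (hF : ∀ V : Submodule 𝕜 H, FiniteDimensional 𝕜 V → F ≤ V → ENNReal.ofReal γ ≤ P.infSup V)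
    (hθ : 0 < θ) (hθ' : θ < thetaOpt Cstb Crel γ) (hmesh : r.MeshClosure Cmesh)
    (hr : r.limitSpace = Set.univ) :
    ∃ k : ℕ, ∀ s : ℝ, 0 < s → ∃ Copt : ℝ, 0 < Copt ∧ ∀ C ≥ Copt,
      (D.approxNorm P s < ⊤ ↔ r.RateFrom s C k) := by
  obtain ⟨γ', hγ', hlt, hθγ'⟩ := exists_lt_thetaOpt hγ hθ'
  have hfinite := fun l => D.finiteDimensional _ (r.admissible l)
  obtain ⟨N, hN⟩ := P.exists_ofReal_le_infSup hγ hlt hF r.monotone_X hr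
  have hinf : Discretization.UniformInfSup P D (r.mesh N) γ' := fun T hT =>
    hN _ (D.nested _ _ (r.admissible N) hT)
  obtain ⟨ε, hε, hε', hrates⟩ := AFEM.exists_optimal_rates hA1 hA2 hA3 hA4 hsons hoverlay hCstb
    hqred hqred' hCrel hCmesh hCmark hγ' (r.admissible N) hinf hθ hθγ'
  obtain ⟨l₃, horth⟩ := r.exists_quasiOrthogonalFrom hr hε hε'
  refine ⟨max l₃ N, fun s hs => ?_⟩
  obtain ⟨Copt, hCopt, hiff⟩ := hrates s hs (r.mesh (max l₃ N)).card
  exact ⟨Copt, hCopt, fun C hC => hiff C hC r hmesh _ (horth.mono (le_max_left _ _))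
    (fun l hl => r.refines_of_le ((le_max_right _ _).trans hl)) rfl⟩

end Rates

end AFEM

end

theorem theorem4p3 {𝕜 : Type*} [RCLike 𝕜] {H : Type*} [NormedAddCommGroup H]
    [InnerProductSpace 𝕜 H] [CompleteSpace H] [TopologicalSpace.SeparableSpace H]
    {d : ℕ} {Ω : Set (EuclideanSpace ℝ (Fin d))}
    (P : AFEM.Problem 𝕜 H) (D : AFEM.Discretization 𝕜 H Ω)
    (Cstb Cred qred Crel' Crel Cmesh Cmark : ℝ) (Cson : ℕ)
    (hCstb : 0 < Cstb) (hCred : 0 < Cred) (hqred : 0 < qred) (hqred' : qred < 1)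
    (hCrel' : 0 < Crel') (hCrel : 0 < Crel) (hCmesh : 1 ≤ Cmesh) (hCmark : 1 ≤ Cmark)
    (hA1 : D.Stability P Cstb) (hA2 : D.Reduction P Cred qred)
    (hA3 : D.Reliability P Crel') (hA4 : D.DiscreteReliability P Crel)
    (hsons : D.SonBounds Cson) (hoverlay : D.Overlay) :
    -- some uniform refinement has a uniform inf-sup bound for all larger discrete spaces
    (∃ (m : ℕ) (γ : ℝ), 0 < γ ∧ ∀ V : Submodule 𝕜 H, FiniteDimensional 𝕜 V →
      D.X (D.uniform m) ≤ V → ENNReal.ofReal γ ≤ P.infSup V) ∧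
    -- optimal rates, with the dependence of the indices and of the constant
    (∀ (m : ℕ) (γ : ℝ), 0 < γ →
      (∀ T, D.S.Refines (D.uniform m) T → ENNReal.ofReal γ ≤ P.infSup (D.X T)) →
      ∀ θ : ℝ, 0 < θ → θ < AFEM.thetaOpt Cstb Crel γ →
      ∃ ε : ℝ, 0 < ε ∧ ε < 1 ∧
        (∀ r : AFEM.AdaptiveRun P D θ Cmark, r.MeshClosure Cmesh → r.LimitDefinite →
          r.limitSpace = Set.univ → ∃ l₃ : ℕ, r.QuasiOrthogonalFrom ε l₃) ∧
        ∀ s : ℝ, 0 < s → ∀ n : ℕ, ∃ Copt : ℝ, 0 < Copt ∧ ∀ C ≥ Copt,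
          ∀ r : AFEM.AdaptiveRun P D θ Cmark, r.MeshClosure Cmesh → r.LimitDefinite →
          r.limitSpace = Set.univ →
          ∀ l₃ l₅ : ℕ, r.QuasiOrthogonalFrom ε l₃ →
          (∀ l ≥ l₅, D.S.Refines (D.uniform m) (r.mesh l)) →
          (r.mesh (max l₃ l₅)).card = n →
          (D.approxNorm P s < ⊤ ↔ r.RateFrom s C (max l₃ l₅))) ∧
    -- optimal rates without reference to the indices
    (∀ (m : ℕ) (γ : ℝ), 0 < γ →
      (∀ V : Submodule 𝕜 H, FiniteDimensional 𝕜 V → D.X (D.uniform m) ≤ V →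
        ENNReal.ofReal γ ≤ P.infSup V) →
      ∀ θ : ℝ, 0 < θ → θ < AFEM.thetaOpt Cstb Crel γ →
      ∀ r : AFEM.AdaptiveRun P D θ Cmark, r.MeshClosure Cmesh → r.LimitDefinite →
      r.limitSpace = Set.univ →
      ∃ l₆ : ℕ, ∀ s : ℝ, 0 < s → ∃ Copt : ℝ, 0 < Copt ∧ ∀ C ≥ Copt,
        (D.approxNorm P s < ⊤ ↔ r.RateFrom s C l₆)) := by
  have hCmesh0 : 0 ≤ Cmesh := zero_le_one.trans hCmesh
  have hCmark0 : 0 < Cmark := zero_lt_one.trans_le hCmark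
  refine ⟨?_, ?_, ?_⟩
  · obtain ⟨m, γ, hγ, hinf⟩ := P.exists_le_infSup (AFEM.Discretization.monotone_X_uniform (D := D))
      AFEM.Discretization.dense_uniform
    exact ⟨m, γ, hγ, fun V _ hV => hinf V hV⟩
  · intro m γ hγ hinf θ hθ hθ'
    obtain ⟨ε, hε, hε', hrates⟩ := AFEM.exists_optimal_rates hA1 hA2 hA3 hA4 hsons hoverlay hCstb
      hqred hqred' hCrel hCmesh0 hCmark0 hγ (AFEM.Discretization.admissible_uniform m) hinf hθ hθ'
    refine ⟨ε, hε, hε', fun r _ _ hr => r.exists_quasiOrthogonalFrom hr hε hε', fun s hs n => ?_⟩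
    obtain ⟨Copt, hCopt, hiff⟩ := hrates s hs n
    exact ⟨Copt, hCopt, fun C hC r hmesh _ _ l₃ l₅ horth href hn =>
      hiff C hC r hmesh _ (horth.mono (le_max_left _ _))
        (fun l hl => href l ((le_max_right _ _).trans hl)) hn⟩
  · intro m γ hγ hinf θ hθ hθ' r hmesh _ hr
    have := D.finiteDimensional _ (AFEM.Discretization.admissible_uniform m)
    exact r.exists_optimal_rates hA1 hA2 hA3 hA4 hsons hoverlay hCstb hqred hqred' hCrel hCmesh0
      hCmark0 hγ hinf hθ hθ' hmesh hr
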